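/- For a finite simple graph $G$ and $k\in\mathbb N$, a b-coloring of $G$ with $k$ colors is a proper coloring $c:V(G)\to\{1,\dots,k\}$ such that for every color $i$ there is a vertex $x_i$ with $c(x_i)=i$ that has, for every color $j\ne i$, a neighbor of color $j$. Let $\Delta=\Delta(G)$ be the maximum degree of $G$ and let $\ell=\ell_k(G)$ be the number of vertices of $G$ of degree at least $k$. Consider the problem b-Coloring: given $(G,k)$, decide whether $G$ has a b-coloring with $k$ colors, parameterized by $\Delta+\ell$. A kernelization algorithm for this problem is a polynomial-time algorithm that on input $(G,k)$ either correctly decides whether $G$ has a b-coloring with $k$ colors, or outputs an instance $(G',k')$ such that $G'$ has a b-coloring with $k'$ colors if and only if $G$ has a b-coloring with $k$ colors, and such that the encoding length of $(G',k')$ plus its parameter $\Delta(G')+\ell_{k'}(G')$ is at most $f(\Delta+\ell)$ for a fixed computable function $f$. Statement. There are a kernelization algorithm for b-Coloring parameterized by $\Delta+\ell$ and an absolute constant $C$ such that every instance $(G',k')$ that it outputs on an input $(G,k)$ satisfies $$|V(G')|\le C\cdot \ell\cdot\Delta\cdot\min\{\ell,\Delta\}^{\ell+1}\quad\text{if } k<\ell,\qquad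 |V(G')|\le C\cdot k^4\cdot\Delta\quad\text{if } \ell\le k .$$ -/

import Mathlib

/-! ### b-colorings and degree parameters of a finite simple graph -/

/-- A proper coloring `c` of `G` with color set `Fin k` is a b-coloring if every color `i` has a
b-vertex: a vertex of color `i` with a neighbor of each other color. -/
def IsBColoring {V : Type*} (G : SimpleGraph V) {k : ℕ} (c : G.Coloring (Fin k)) : Prop :=
  ∀ i : Fin k, ∃ x : V, c x = i ∧ ∀ j : Fin k, j ≠ i → ∃ y : V, G.Adj x y ∧ c y = j

/-- `G` has a b-coloring with `k` colors. -/
def HasBColoring {V : Type*} (G : SimpleGraph V) (k : ℕ) : Prop :=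
  ∃ c : G.Coloring (Fin k), IsBColoring G c

open Classical in
/-- `Δ(G)`, the maximum degree. -/
noncomputable def maxDeg {V : Type*} [Fintype V] (G : SimpleGraph V) : ℕ := G.maxDegree

open Classical in
/-- `ℓ_k(G)`, the number of vertices of degree at least `k`. -/
noncomputable def numHighDeg {V : Type*} [Fintype V] (G : SimpleGraph V) (k : ℕ) : ℕ :=
  (Finset.univ.filter fun v : V => k ≤ G.degree v).card

/-! ### A random access machine with a step count

A machine has integer registers, finitely many of which occur in a program, and arrays that are
addressed indirectly. The arithmetic operations are addition and truncated subtraction, at unit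
cost. (There is no unit-cost multiplication, so in `t` steps the bit lengths of numbers grow by at
most `O(t)`: polynomial time on this machine is the usual polynomial time.) -/

namespace Ram

structure State where
  /-- registers -/
  reg : ℕ → ℕ
  /-- `arr a i` is the cell number `i` of the array number `a` -/
  arr : ℕ → ℕ → ℕ
  /-- what has been written to the output tape so far -/
  out : List ℕ

inductive Expr where
  | const (c : ℕ)
  | reg (r : ℕ)
  | get (a : ℕ) (i : Expr)
  | add (e₁ e₂ : Expr)
  | sub (e₁ e₂ : Expr)

def Expr.eval (s : State) : Expr → ℕ
  | .const c => c
  | .reg r => s.reg r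
  | .get a i => s.arr a (i.eval s)
  | .add e₁ e₂ => e₁.eval s + e₂.eval s
  | .sub e₁ e₂ => e₁.eval s - e₂.eval s

/-- The number of steps that the evaluation of an expression takes. -/
def Expr.cost : Expr → ℕ
  | .const _ => 1
  | .reg _ => 1
  | .get _ i => i.cost + 1
  | .add e₁ e₂ => e₁.cost + e₂.cost + 1
  | .sub e₁ e₂ => e₁.cost + e₂.cost + 1

inductive Prog where
  | skip
  /-- assign the value of `e` to register `r` -/
  | set (r : ℕ) (e : Expr)
  /-- assign the value of `e` to cell `i` of array `a` -/
  | put (a : ℕ) (i e : Expr)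
  /-- append the value of `e` to the output tape -/
  | emit (e : Expr)
  | seq (p q : Prog)
  /-- run `p` if the value of `e` is nonzero, otherwise `q` -/
  | ite (e : Expr) (p q : Prog)
  /-- run `p` as long as the value of `e` is nonzero -/
  | loop (e : Expr) (p : Prog)

/-- `Exec p s t s'`: started in state `s`, the program `p` halts after `t` steps in state `s'`. -/
inductive Exec : Prog → State → ℕ → State → Prop
  | skip (s : State) : Exec .skip s 1 s
  | set (s : State) (r : ℕ) (e : Expr) :
      Exec (.set r e) s (e.cost + 1) { s with reg := Function.update s.reg r (e.eval s) }
  | put (s : State) (a : ℕ) (i e : Expr) :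
      Exec (.put a i e) s (i.cost + e.cost + 1)
        { s with
          arr := Function.update s.arr a (Function.update (s.arr a) (i.eval s) (e.eval s)) }
  | emit (s : State) (e : Expr) :
      Exec (.emit e) s (e.cost + 1) { s with out := s.out ++ [e.eval s] }
  | seq {p q : Prog} {s s' s'' : State} {t t' : ℕ} :
      Exec p s t s' → Exec q s' t' s'' → Exec (.seq p q) s (t + t') s''
  | iteTrue {e : Expr} {p q : Prog} {s s' : State} {t : ℕ} :
      e.eval s ≠ 0 → Exec p s t s' → Exec (.ite e p q) s (e.cost + 1 + t) s'
  | iteFalse {e : Expr} {p q : Prog} {s s' : State} {t : ℕ} :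
      e.eval s = 0 → Exec q s t s' → Exec (.ite e p q) s (e.cost + 1 + t) s'
  | loopDone {e : Expr} {p : Prog} {s : State} :
      e.eval s = 0 → Exec (.loop e p) s (e.cost + 1) s
  | loopStep {e : Expr} {p : Prog} {s s' s'' : State} {t t' : ℕ} :
      e.eval s ≠ 0 → Exec p s t s' → Exec (.loop e p) s' t' s'' →
        Exec (.loop e p) s (e.cost + 1 + t + t') s''

/-- The initial state on input `w`: the word is in array 0, its length in register 0, everything
else is zero and the output tape is empty. -/
def init (w : List ℕ) : State where
  reg := fun r => if r = 0 then w.length else 0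
  arr := fun a i => if a = 0 then w.getD i 0 else 0
  out := []

end Ram

/-- The length of a finite sequence of numbers written in binary, with separators. -/
def bitLength (w : List ℕ) : ℕ := (w.map fun a => Nat.size a + 1).sum

/-- `F` is computed by one program, in time polynomial in the bit length of the encoded input. -/
def PolyTimeComputable {α β : Type*} (encα : α → List ℕ) (encβ : β → List ℕ) (F : α → β) : Prop :=
  ∃ (A : Ram.Prog) (p : Polynomial ℕ), ∀ a : α, ∃ (t : ℕ) (s : Ram.State),
    Ram.Exec A (Ram.init (encα a)) t s ∧ s.out = encβ (F a) ∧ t ≤ p.eval (bitLength (encα a))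

/-! ### Parameterized problems and kernels -/

/-- A parameterized decision problem with instances in `ι`. -/
structure ParamProblem (ι : Type*) where
  encode : ι → List ℕ
  param : ι → ℕ
  yes : ι → Prop

/-- A kernelization algorithm either decides its input or returns another instance. -/
inductive KernelOutput (ι : Type*) where
  | decided (b : Bool)
  | reduced (y : ι)

def KernelOutput.encode {ι : Type*} (enc : ι → List ℕ) : KernelOutput ι → List ℕ
  | .decided false => [0]
  | .decided true => [1]
  | .reduced y => 2 :: enc y

/-- `K` is a kernelization algorithm for `P`: it runs in polynomial time, its decisions are
correct, and an instance that it returns is equivalent to the input, with size plus parameter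
bounded by a computable function of the parameter of the input. -/
def IsKernelization {ι : Type*} (P : ParamProblem ι) (K : ι → KernelOutput ι) : Prop :=
  PolyTimeComputable P.encode (KernelOutput.encode P.encode) K ∧
  (∀ x b, K x = .decided b → (b = true ↔ P.yes x)) ∧
  (∀ x y, K x = .reduced y → (P.yes x ↔ P.yes y)) ∧
  ∃ f : ℕ → ℕ, Computable f ∧ ∀ x y, K x = .reduced y →
    bitLength (P.encode y) + P.param y ≤ f (P.param x)

/-! ### The problem b-Coloring parameterized by `Δ(G) + ℓ_k(G)` -/

/-- An instance `(G, k)`; the vertex set of `G` is `{0, …, n - 1}`. -/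
structure BInstance where
  n : ℕ
  G : SimpleGraph (Fin n)
  k : ℕ

open Classical in
/-- The encoding of an instance: `n`, `k`, and the adjacency matrix row by row. -/
noncomputable def BInstance.encode (I : BInstance) : List ℕ :=
  I.n :: I.k :: (List.finRange I.n).flatMap fun u =>
    (List.finRange I.n).map fun v => if I.G.Adj u v then 1 else 0

noncomputable def BInstance.Δ (I : BInstance) : ℕ := maxDeg I.G

noncomputable def BInstance.ell (I : BInstance) : ℕ := numHighDeg I.G I.k

noncomputable def bColoringProblem : ParamProblem BInstance where
  encode := BInstance.encode
  param := fun I => I.Δ + I.ell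
  yes := fun I => HasBColoring I.G I.k

/-!
A b-vertex has degree at least `k - 1`. The kernel keeps all vertices of degree at least `k` and the
first `k ^ 4 + ℓ * Δ * k` vertices of degree exactly `k - 1`, together with their neighborhoods. All
other vertices have degree less than `k`, so a b-coloring of the kernel extends greedily to `G`.

Conversely, if all vertices of degree `k - 1` are kept, then a b-coloring of `G` restricts to one of
the kernel. Otherwise at most `ℓ * Δ * k` of the kept ones are within distance 2 of a vertex of
degree at least `k`, and each of the others excludes at most `k ^ 3` vertices at distance at most 3,
so `k` of them are pairwise at distance at least 4. The neighborhoods of these `k` vertices can be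
recolored independently, starting from any proper coloring, to make them b-vertices of the `k`
colors.
-/

section Coloring

open Classical Finset

variable {V V' α ι : Type*} {G : SimpleGraph V} {k : ℕ}

/-- A vertex that sees every color other than its own. -/
def IsBVertex (c : G.Coloring α) (x : V) : Prop :=
  ∀ j, j ≠ c x → ∃ y, G.Adj x y ∧ c y = j

theorem isBColoring_iff {c : G.Coloring (Fin k)} :
    IsBColoring G c ↔ ∀ i, ∃ x, c x = i ∧ IsBVertex c x := by
  refine forall_congr' fun i => exists_congr fun x => and_congr_right ?_
  rintro rfl
  exact Iff.rfl

theorem edist_le_iff_exists_walk {u v : V} {r : ℕ} :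
    G.edist u v ≤ r ↔ ∃ p : G.Walk u v, p.length ≤ r := by
  refine ⟨fun h => ?_, fun ⟨p, hp⟩ => (SimpleGraph.edist_le p).trans (mod_cast hp)⟩
  obtain ⟨p, hp⟩ := SimpleGraph.exists_walk_of_edist_ne_top
    (ne_top_of_le_ne_top (ENat.natCast_ne_top r) h)
  rw [← hp] at h
  exact ⟨p, mod_cast h⟩

theorem exists_pairwise_notMem_of_mul_le_card (F : Finset α) (conf : α → Finset α)
    (hrefl : ∀ x, x ∈ conf x) (hsymm : ∀ x y, y ∈ conf x ↔ x ∈ conf y) {m : ℕ} (hm : 0 < m)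
    (hconf : ∀ x ∈ F, #(conf x) ≤ m) (j : ℕ) (hj : j * m ≤ #F) :
    ∃ T ⊆ F, #T = j ∧ (T : Set α).Pairwise fun x y => y ∉ conf x := by
  induction j with
  | zero => exact ⟨∅, empty_subset F, card_empty, by simp⟩
  | succ j ih =>
    rw [add_one_mul] at hj
    obtain ⟨T, hTF, rfl, hpair⟩ := ih (by omega)
    have hblocked : #(T.biUnion conf) ≤ #T * m :=
      card_biUnion_le_card_mul _ _ _ fun x hx => hconf x (hTF hx)
    obtain ⟨x, hxF, hx⟩ : ∃ x ∈ F, x ∉ T.biUnion conf :=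
      exists_mem_notMem_of_card_lt_card (by omega)
    simp only [mem_biUnion, not_exists, not_and] at hx
    have hxT : x ∉ T := fun h => hx x h (hrefl x)
    refine ⟨insert x T, insert_subset hxF hTF, card_insert_of_notMem hxT, ?_⟩
    rw [coe_insert, Set.pairwise_insert_of_notMem (by simpa using hxT)]
    exact ⟨hpair, fun y hy => ⟨fun h => hx y hy ((hsymm x y).1 h), hx y hy⟩⟩

theorem exists_bijOn_univ_apply_eq [Fintype α] {S : Finset V} (hS : #S = Fintype.card α) (x : V)
    (i : α) : ∃ g : V → α, Set.BijOn g S Set.univ ∧ g x = i := by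
  have : Nonempty α := ⟨i⟩
  obtain ⟨g, hg⟩ := S.finite_toSet.exists_bijOn_of_encard_eq (t := (Set.univ : Set α))
    (by simp [Set.encard_coe_eq_coe_finsetCard, hS])
  exact ⟨Equiv.swap (g x) i ∘ g, (Equiv.swap (g x) i).bijective.bijOn_univ.comp hg,
    Equiv.swap_apply_left _ _⟩

/-- The first `m` elements of `S`, or all of them if there are fewer. -/
noncomputable def initialSegment [LinearOrder α] (S : Finset α) (m : ℕ) : Finset α :=
  S.filter fun v => #(S.filter (· < v)) < m

theorem card_initialSegment [LinearOrder α] (S : Finset α) (m : ℕ) :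
    #(initialSegment S m) = min #S m := by
  induction S using Finset.induction_on_max with
  | empty => simp [initialSegment]
  | insert a S ha ih =>
    have haS : a ∉ S := fun h => (ha a h).false
    have hlt : ∀ v ∈ insert a S, (insert a S).filter (· < v) = S.filter (· < v) := fun v hv => by
      rw [filter_insert, if_neg]
      rcases mem_insert.1 hv with rfl | hv
      · exact lt_irrefl _
      · exact (ha v hv).not_gt
    have hseg : initialSegment (insert a S) m =
        if #S < m then insert a (initialSegment S m) else initialSegment S m := by
      rw [initialSegment, filter_congr fun v hv => by rw [hlt v hv], filter_insert,
        filter_true_of_mem ha]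
      rfl
    have ha_seg : a ∉ initialSegment S m := fun h => haS (mem_of_mem_filter a h)
    rw [hseg, card_insert_of_notMem haS]
    split_ifs with h
    · rw [card_insert_of_notMem ha_seg, ih]
      omega
    · rw [ih]
      omega

variable [Fintype V]

/-- The closed neighborhood of a vertex. -/
noncomputable def closedNbhd (G : SimpleGraph V) (v : V) : Finset V :=
  insert v (G.neighborFinset v)

theorem mem_closedNbhd {u v : V} : u ∈ closedNbhd G v ↔ u = v ∨ G.Adj v u := by
  simp [closedNbhd]

theorem mem_closedNbhd_comm {u v : V} : u ∈ closedNbhd G v ↔ v ∈ closedNbhd G u := by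
  simp only [mem_closedNbhd, G.adj_comm, eq_comm]

theorem self_mem_closedNbhd (v : V) : v ∈ closedNbhd G v := mem_closedNbhd.2 (Or.inl rfl)

theorem card_closedNbhd (v : V) : #(closedNbhd G v) = G.degree v + 1 := by
  simp [closedNbhd]

theorem card_biUnion_closedNbhd_le [DecidableEq V] {S : Finset V} {m : ℕ}
    (h : ∀ v ∈ S, G.degree v < m) : #(S.biUnion (closedNbhd G)) ≤ #S * m :=
  card_biUnion_le_card_mul _ _ _ fun v hv => (card_closedNbhd v).trans_le (h v hv)

/-- The vertices at distance at most `r` from `v`. -/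
noncomputable def closedBall (G : SimpleGraph V) (v : V) (r : ℕ) : Finset V :=
  univ.filter fun u => G.edist u v ≤ r

theorem mem_closedBall {u v : V} {r : ℕ} : u ∈ closedBall G v r ↔ G.edist u v ≤ r :=
  mem_filter_univ u

theorem mem_closedBall_comm {u v : V} {r : ℕ} : u ∈ closedBall G v r ↔ v ∈ closedBall G u r := by
  rw [mem_closedBall, mem_closedBall, G.edist_comm]

theorem closedBall_zero (v : V) : closedBall G v 0 = {v} := by
  ext u
  simp [mem_closedBall]

theorem closedBall_one (v : V) : closedBall G v 1 = closedNbhd G v := by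
  ext u
  simp [mem_closedBall, mem_closedNbhd, SimpleGraph.edist_le_one_iff_adj_or_eq, G.adj_comm,
    or_comm]

theorem closedBall_succ (v : V) (r : ℕ) :
    closedBall G v (r + 1) = (closedBall G v r).biUnion (closedNbhd G) := by
  ext u
  simp only [mem_biUnion, mem_closedBall, edist_le_iff_exists_walk, mem_closedNbhd]
  constructor
  · rintro ⟨p, hp⟩
    cases p with
    | nil => exact ⟨v, ⟨.nil, by simp⟩, Or.inl rfl⟩
    | cons huw p => exact ⟨_, ⟨p, by simpa using hp⟩, Or.inr huw.symm⟩
  · rintro ⟨w, ⟨p, hp⟩, rfl | hwu⟩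
    · exact ⟨p, by omega⟩
    · exact ⟨.cons hwu.symm p, by simpa using hp⟩

theorem mem_closedBall_succ {u v : V} {r : ℕ} :
    u ∈ closedBall G v (r + 1) ↔ ∃ w ∈ closedBall G v r, u ∈ closedNbhd G w := by
  rw [closedBall_succ, mem_biUnion]

theorem mem_closedBall_two {u v : V} :
    u ∈ closedBall G v 2 ↔ ∃ w ∈ closedNbhd G v, u ∈ closedNbhd G w := by
  rw [mem_closedBall_succ, closedBall_one]

theorem card_closedBall_succ_le {v : V} {r : ℕ} (h : ∀ u ∈ closedBall G v r, G.degree u < k) :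
    #(closedBall G v (r + 1)) ≤ k ^ (r + 1) := by
  have step : #(closedBall G v (r + 1)) ≤ #(closedBall G v r) * k := by
    rw [closedBall_succ]
    exact card_biUnion_closedNbhd_le h
  induction r with
  | zero => simpa [closedBall_zero] using step
  | succ r ih =>
    have h' : ∀ u ∈ closedBall G v r, G.degree u < k :=
      fun u hu => h u (mem_closedBall_succ.2 ⟨u, hu, self_mem_closedNbhd u⟩)
    refine step.trans (Nat.mul_le_mul_right k (ih h' ?_))
    rw [closedBall_succ]
    exact card_biUnion_closedNbhd_le h'

theorem isBVertex_iff_surjOn {c : G.Coloring α} {x : V} :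
    IsBVertex c x ↔ Set.SurjOn c (closedNbhd G x) Set.univ := by
  refine ⟨fun h j _ => ?_, fun h j hj => ?_⟩
  · by_cases hj : j = c x
    · exact ⟨x, self_mem_closedNbhd x, hj.symm⟩
    · obtain ⟨y, hxy, hy⟩ := h j hj
      exact ⟨y, mem_closedNbhd.2 (Or.inr hxy), hy⟩
  · obtain ⟨y, hy, rfl⟩ := h (Set.mem_univ j)
    exact ⟨y, (mem_closedNbhd.1 hy).resolve_left fun hyx => hj (congrArg c hyx), rfl⟩

theorem IsBVertex.card_le_degree_add_one [Fintype α] {c : G.Coloring α} {x : V}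
    (h : IsBVertex c x) : Fintype.card α ≤ G.degree x + 1 := by
  rw [← card_closedNbhd, ← card_univ]
  exact card_le_card_of_surjOn c (by simpa using isBVertex_iff_surjOn.1 h)

theorem exists_coloring_eqOn [Fintype α] (S : Finset V) (c₀ : V → α)
    (hproper : ∀ u ∈ S, ∀ v ∈ S, G.Adj u v → c₀ u ≠ c₀ v)
    (hdeg : ∀ v ∉ S, G.degree v < Fintype.card α) :
    ∃ c : G.Coloring α, Set.EqOn c c₀ S := by
  suffices key : ∀ R : Finset V, ∃ c : V → α, Set.EqOn c c₀ S ∧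
      ∀ u ∈ S ∪ R, ∀ v ∈ S ∪ R, G.Adj u v → c u ≠ c v by
    obtain ⟨c, hc, hp⟩ := key univ
    exact ⟨SimpleGraph.Coloring.mk c fun {u v} => hp u (by simp) v (by simp), hc⟩
  intro R
  induction R using Finset.induction_on with
  | empty => exact ⟨c₀, Set.eqOn_refl _ _, by simpa using hproper⟩
  | insert w R _ ih =>
    obtain ⟨c, hc, hp⟩ := ih
    by_cases hw : w ∈ S
    · rw [union_insert, insert_eq_of_mem (mem_union_left R hw)]
      exact ⟨c, hc, hp⟩
    obtain ⟨i, -, hi⟩ : ∃ i ∈ univ, i ∉ (G.neighborFinset w).image c :=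
      exists_mem_notMem_of_card_lt_card
        (card_image_le.trans_lt ((G.card_neighborFinset_eq_degree w).trans_lt (hdeg w hw)))
    simp only [mem_image, SimpleGraph.mem_neighborFinset, not_exists, not_and] at hi
    refine ⟨Function.update c w i, fun v hv => ?_, fun u hu v hv huv => ?_⟩
    · rw [Function.update_of_ne (ne_of_mem_of_not_mem hv hw), hc hv]
    rw [union_insert, mem_insert] at hu hv
    rcases eq_or_ne u w with rfl | huw
    · rw [Function.update_self, Function.update_of_ne huv.ne']
      exact fun h => hi v huv h.symm
    rcases eq_or_ne v w with rfl | hvw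
    · rw [Function.update_self, Function.update_of_ne huv.ne]
      exact hi u huv.symm
    rw [Function.update_of_ne huw, Function.update_of_ne hvw]
    exact hp u (hu.resolve_left huw) v (hv.resolve_left hvw) huv

theorem exists_coloring_extending_comap [Fintype α] (e : V' ↪ V) (c : (G.comap e).Coloring α)
    (hdeg : ∀ v ∉ Set.range e, G.degree v < Fintype.card α) :
    ∃ c' : G.Coloring α, ∀ w, c' (e w) = c w := by
  rcases isEmpty_or_nonempty α with hα | ⟨⟨a⟩⟩
  · have hV : IsEmpty V := ⟨fun v => by
      by_cases hv : v ∈ Set.range e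
      · exact hα.false (c hv.choose)
      · simpa using hdeg v hv⟩
    exact ⟨SimpleGraph.Coloring.mk isEmptyElim fun {v} => isEmptyElim v, fun w => isEmptyElim (e w)⟩
  let c₀ : V → α := Function.extend e c fun _ => a
  have hc₀ : ∀ w, c₀ (e w) = c w := e.injective.extend_apply _ _
  obtain ⟨c', hc'⟩ := exists_coloring_eqOn (G := G) (univ.filter (· ∈ Set.range e)) c₀
    (by
      simp only [mem_filter_univ]
      rintro _ ⟨u, rfl⟩ _ ⟨v, rfl⟩ huv
      rw [hc₀, hc₀]
      exact c.valid huv)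
    (fun v hv => hdeg v (by simpa using hv))
  exact ⟨c', fun w => (hc' (by simp)).trans (hc₀ w)⟩

theorem HasBColoring.of_comap (e : V' ↪ V) (hdeg : ∀ v ∉ Set.range e, G.degree v < k)
    (h : HasBColoring (G.comap e) k) : HasBColoring G k := by
  obtain ⟨c, hc⟩ := h
  obtain ⟨c', hc'⟩ := exists_coloring_extending_comap e c (by simpa using hdeg)
  refine ⟨c', fun i => ?_⟩
  obtain ⟨x, hx, hb⟩ := hc i
  refine ⟨e x, (hc' x).trans hx, fun j hj => ?_⟩
  obtain ⟨y, hxy, hy⟩ := hb j hj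
  exact ⟨e y, hxy, (hc' y).trans hy⟩

theorem hasBColoring_comap_of_bVertices (e : V' ↪ V) (c : G.Coloring (Fin k))
    (h : ∀ i, ∃ x, ↑(closedNbhd G x) ⊆ Set.range e ∧ c x = i ∧ IsBVertex c x) :
    HasBColoring (G.comap e) k := by
  refine ⟨SimpleGraph.Coloring.mk (c ∘ e) fun {u v} huv => c.valid huv, fun i => ?_⟩
  obtain ⟨x, hx, rfl, hb⟩ := h i
  obtain ⟨x', rfl⟩ := hx (self_mem_closedNbhd x)
  refine ⟨x', rfl, fun j hj => ?_⟩
  obtain ⟨y, hxy, rfl⟩ := hb j hj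
  obtain ⟨y', rfl⟩ := hx (mem_closedNbhd.2 (Or.inr hxy))
  exact ⟨y', hxy, rfl⟩

/-- Only the vertices of large degree keep the colors of `c`; the remaining vertices outside the
sets `B i` are recolored greedily. -/
theorem exists_coloring_eqOn_of_separated [Fintype α] (c : G.Coloring α) (B : ι → Finset V)
    (g : ι → V → α) (hproper : ∀ i, ∀ u ∈ B i, ∀ v ∈ B i, G.Adj u v → g i u ≠ g i v)
    (hlow : ∀ i, ∀ u ∈ B i, ∀ v ∈ closedNbhd G u, G.degree v < Fintype.card α)
    (hsep : ∀ i j, i ≠ j → ∀ u ∈ B i, ∀ v ∈ closedNbhd G u, v ∉ B j) :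
    ∃ c' : G.Coloring α, ∀ i, Set.EqOn c' (g i) (B i) := by
  let c₀ : V → α := fun v => if h : ∃ i, v ∈ B i then g h.choose v else c v
  have hc₀B : ∀ i, ∀ u ∈ B i, c₀ u = g i u := by
    intro i u hu
    have h : ∃ i, u ∈ B i := ⟨i, hu⟩
    have hi : h.choose = i := by
      by_contra hne
      exact hsep _ _ hne u h.choose_spec u (self_mem_closedNbhd u) hu
    rw [← hi]
    exact dif_pos h
  have hc₀high : ∀ v, Fintype.card α ≤ G.degree v → c₀ v = c v := fun v hv =>
    dif_neg fun ⟨i, hi⟩ => (hlow i v hi v (self_mem_closedNbhd v)).not_ge hv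
  obtain ⟨c', hc'⟩ := exists_coloring_eqOn (G := G)
    (univ.filter fun v => Fintype.card α ≤ G.degree v ∨ ∃ i, v ∈ B i) c₀
    (by
      simp only [mem_filter_univ]
      intro u hu v hv huv
      have hvu : v ∈ closedNbhd G u := mem_closedNbhd.2 (Or.inr huv)
      rcases hu with hu | ⟨i, hi⟩ <;> rcases hv with hv | ⟨j, hj⟩
      · rw [hc₀high u hu, hc₀high v hv]
        exact c.valid huv
      · exact absurd hu (hlow j v hj u (mem_closedNbhd_comm.1 hvu)).not_ge
      · exact absurd hv (hlow i u hi v hvu).not_ge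
      · obtain rfl : i = j := by
          by_contra hij
          exact hsep i j hij u hi v hvu hj
        rw [hc₀B i u hi, hc₀B i v hj]
        exact hproper i u hi v hj huv)
    (fun v hv => by
      simp only [mem_filter_univ, not_or, not_le] at hv
      exact hv.1)
  exact ⟨c', fun i u hu => (hc' (by simpa using Or.inr ⟨i, hu⟩)).trans (hc₀B i u hu)⟩

theorem exists_coloring_isBVertex_of_scattered [Fintype α] (c : G.Coloring α) (f : α → V)
    (hdeg : ∀ i, G.degree (f i) + 1 = Fintype.card α)
    (hfar : ∀ i, ∀ v ∈ closedBall G (f i) 2, G.degree v < Fintype.card α)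
    (hsep : ∀ i j, i ≠ j → f j ∉ closedBall G (f i) 3) :
    ∃ c' : G.Coloring α, ∀ i, c' (f i) = i ∧ IsBVertex c' (f i) := by
  have hpalette : ∀ i, ∃ g : V → α, Set.BijOn g (closedNbhd G (f i)) Set.univ ∧ g (f i) = i :=
    fun i => exists_bijOn_univ_apply_eq (by rw [card_closedNbhd, hdeg]) _ i
  choose g hg hgi using hpalette
  obtain ⟨c', hc'⟩ := exists_coloring_eqOn_of_separated c (fun i => closedNbhd G (f i)) g
    (fun i u hu v hv huv h => huv.ne ((hg i).injOn hu hv h))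
    (fun i u hu v hv => hfar i v (mem_closedBall_two.2 ⟨u, hu, hv⟩))
    (fun i j hij u hu v hv hvj => hsep i j hij <| mem_closedBall_succ.2
      ⟨v, mem_closedBall_two.2 ⟨u, hu, hv⟩, mem_closedNbhd_comm.1 hvj⟩)
  refine ⟨c', fun i => ⟨(hc' i (self_mem_closedNbhd _)).trans (hgi i), ?_⟩⟩
  exact isBVertex_iff_surjOn.2 ((hc' i).surjOn_iff.2 (hg i).surjOn)

/-- The vertices of degree at least `k`. -/
noncomputable def highSet (G : SimpleGraph V) (k : ℕ) : Finset V :=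
  univ.filter fun v => k ≤ G.degree v

/-- The vertices of degree `k - 1`, the smallest degree that a b-vertex can have. -/
noncomputable def midSet (G : SimpleGraph V) (k : ℕ) : Finset V :=
  univ.filter fun v => G.degree v + 1 = k

/-- The vertices of degree less than `k` within distance 2 of a vertex of degree at least `k`. -/
noncomputable def nearSet (G : SimpleGraph V) (k : ℕ) : Finset V :=
  univ.filter fun x => G.degree x < k ∧ ∃ v ∈ closedBall G x 2, k ≤ G.degree v

/-- So many vertices of degree `k - 1` allow for `k` of them that are pairwise far apart and far
from the vertices of degree at least `k`. -/
noncomputable def scatterBound (G : SimpleGraph V) (k : ℕ) : ℕ :=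
  k ^ 4 + numHighDeg G k * maxDeg G * k

theorem mem_highSet {v : V} : v ∈ highSet G k ↔ k ≤ G.degree v := mem_filter_univ v

theorem mem_midSet {v : V} : v ∈ midSet G k ↔ G.degree v + 1 = k := mem_filter_univ v

theorem card_highSet : #(highSet G k) = numHighDeg G k := rfl

theorem degree_le_maxDeg (v : V) : G.degree v ≤ maxDeg G := G.degree_le_maxDegree v

theorem sup_degree_eq_maxDeg : univ.sup (fun v => G.degree v) = maxDeg G :=
  le_antisymm (Finset.sup_le fun v _ => degree_le_maxDeg v)
    (G.maxDegree_le_of_forall_degree_le _ fun v => le_sup (f := fun v => G.degree v) (mem_univ v))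

theorem card_nearSet_le : #(nearSet G k) ≤ numHighDeg G k * maxDeg G * k := by
  set L := (highSet G k).biUnion (G.neighborFinset ·) \ highSet G k
  have hLcard : #L ≤ numHighDeg G k * maxDeg G :=
    (card_le_card sdiff_subset).trans <| card_biUnion_le_card_mul _ _ _ fun v _ =>
      (G.card_neighborFinset_eq_degree v).trans_le (degree_le_maxDeg v)
  have hLlow : ∀ v ∈ L, G.degree v < k := fun v hv => by
    simpa [mem_highSet] using (mem_sdiff.1 hv).2
  have hLmem : ∀ u v, G.degree u < k → k ≤ G.degree v → v ∈ closedNbhd G u → u ∈ L := by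
    intro u v hu hv huv
    have hadj : G.Adj u v :=
      (mem_closedNbhd.1 huv).resolve_left fun h => (h ▸ hu).not_ge hv
    exact mem_sdiff.2 ⟨mem_biUnion.2 ⟨v, mem_highSet.2 hv, by simpa using hadj.symm⟩,
      fun h => hu.not_ge (mem_highSet.1 h)⟩
  suffices hsub : nearSet G k ⊆ L.biUnion (closedNbhd G) from (card_le_card hsub).trans <|
    (card_biUnion_closedNbhd_le hLlow).trans (Nat.mul_le_mul_right k hLcard)
  intro x hx
  obtain ⟨hxk, v, hv, hvk⟩ := (mem_filter_univ x).1 hx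
  obtain ⟨w, hxw, hwv⟩ := mem_closedBall_two.1 hv
  rcases lt_or_ge (G.degree w) k with hwk | hwk
  · exact mem_biUnion.2 ⟨w, hLmem w v hwk hvk hwv, mem_closedNbhd_comm.1 hxw⟩
  · exact mem_biUnion.2 ⟨x, hLmem x w hxk hwk hxw, self_mem_closedNbhd x⟩

theorem exists_coloring_isBVertex_of_scatterBound_le (c : G.Coloring (Fin k)) {Y : Finset V}
    (hYmid : Y ⊆ midSet G k) (hY : scatterBound G k ≤ #Y) :
    ∃ c' : G.Coloring (Fin k), ∀ i, ∃ x ∈ Y, c' x = i ∧ IsBVertex c' x := by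
  rcases Nat.eq_zero_or_pos k with rfl | hk
  · exact ⟨c, fun i => i.elim0⟩
  have hlow : ∀ x ∈ Y \ nearSet G k, ∀ v ∈ closedBall G x 2, G.degree v < k := by
    intro x hx v hv
    have hxk : G.degree x < k := by
      have := mem_midSet.1 (hYmid (mem_sdiff.1 hx).1)
      omega
    by_contra! hvk
    exact (mem_sdiff.1 hx).2 ((mem_filter_univ x).2 ⟨hxk, v, hv, hvk⟩)
  have hcard : k * k ^ 3 ≤ #(Y \ nearSet G k) := by
    have hdiff := le_card_sdiff (nearSet G k) Y
    have hnear := card_nearSet_le (G := G) (k := k)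
    rw [scatterBound, pow_succ' k 3] at hY
    omega
  obtain ⟨T, hTY, hTcard, hT⟩ := exists_pairwise_notMem_of_mul_le_card (Y \ nearSet G k)
    (fun x => closedBall G x 3) (fun x => by simp [mem_closedBall]) (fun _ _ => mem_closedBall_comm)
    (pow_pos hk 3) (fun x hx => card_closedBall_succ_le (hlow x hx)) k hcard
  let f : Fin k ≃ T := (T.equivFinOfCardEq hTcard).symm
  have hfY : ∀ i, (f i : V) ∈ Y \ nearSet G k := fun i => hTY (f i).2
  obtain ⟨c', hc'⟩ := exists_coloring_isBVertex_of_scattered c (fun i => (f i : V))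
    (fun i => by simpa using mem_midSet.1 (hYmid (mem_sdiff.1 (hfY i)).1))
    (fun i v hv => by simpa using hlow _ (hfY i) v hv)
    (fun i j hij => hT (f i).2 (f j).2 (by simpa [Subtype.ext_iff] using f.injective.ne hij))
  exact ⟨c', fun i => ⟨f i, (mem_sdiff.1 (hfY i)).1, hc' i⟩⟩

theorem hasBColoring_comap_iff (e : V' ↪ V) (X : Finset V)
    (he : ∀ x ∈ X, ↑(closedNbhd G x) ⊆ Set.range e) (hhigh : highSet G k ⊆ X)
    (hmid : midSet G k ⊆ X ∨ ∃ Y ⊆ X, Y ⊆ midSet G k ∧ scatterBound G k ≤ #Y) :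
    HasBColoring (G.comap e) k ↔ HasBColoring G k := by
  refine ⟨HasBColoring.of_comap e fun v hv => ?_, fun ⟨c, hc⟩ => ?_⟩
  · by_contra! hvk
    exact hv (he v (hhigh (mem_highSet.2 hvk)) (self_mem_closedNbhd v))
  rcases hmid with hmid | ⟨Y, hYX, hYmid, hY⟩
  · refine hasBColoring_comap_of_bVertices e c fun i => ?_
    obtain ⟨x, hxi, hx⟩ := isBColoring_iff.1 hc i
    have hdeg : k ≤ G.degree x + 1 := by simpa using hx.card_le_degree_add_one
    have hxX : x ∈ X := by
      rcases hdeg.lt_or_eq with hlt | heq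
      · exact hhigh (mem_highSet.2 (Nat.lt_succ_iff.1 hlt))
      · exact hmid (mem_midSet.2 heq.symm)
    exact ⟨x, he x hxX, hxi, hx⟩
  · obtain ⟨c', hc'⟩ := exists_coloring_isBVertex_of_scatterBound_le c hYmid hY
    refine hasBColoring_comap_of_bVertices e c' fun i => ?_
    obtain ⟨x, hx, hxi⟩ := hc' i
    exact ⟨x, he x (hYX hx), hxi⟩

/-- Vertices that decide the existence of a b-coloring. -/
noncomputable def coreSet [LinearOrder V] (G : SimpleGraph V) (k : ℕ) : Finset V :=
  highSet G k ∪ initialSegment (midSet G k) (scatterBound G k)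

/-- The vertices of the kernel. -/
noncomputable def kernelSet [LinearOrder V] (G : SimpleGraph V) (k : ℕ) : Finset V :=
  (coreSet G k).biUnion (closedNbhd G)

theorem hasBColoring_comap_iff_of_range_eq_kernelSet [LinearOrder V] (e : V' ↪ V)
    (he : Set.range e = kernelSet G k) : HasBColoring (G.comap e) k ↔ HasBColoring G k := by
  have hseg : initialSegment (midSet G k) (scatterBound G k) ⊆ midSet G k := filter_subset _ _
  refine hasBColoring_comap_iff e (coreSet G k) (fun x hx v hv => ?_) subset_union_left ?_
  · rw [he]
    exact mem_biUnion.2 ⟨x, hx, hv⟩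
  have hcard := card_initialSegment (midSet G k) (scatterBound G k)
  rcases le_total #(midSet G k) (scatterBound G k) with h | h
  · left
    rw [min_eq_left h] at hcard
    exact (eq_of_subset_of_card_le hseg hcard.ge).symm.subset.trans subset_union_right
  · right
    rw [min_eq_right h] at hcard
    exact ⟨_, subset_union_right, hseg, hcard.ge⟩

theorem card_kernelSet_le [LinearOrder V] :
    #(kernelSet G k) ≤ numHighDeg G k * (maxDeg G + 1) + scatterBound G k * k := by
  rw [kernelSet, coreSet, union_biUnion]
  refine (card_union_le _ _).trans (Nat.add_le_add ?_ ?_)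
  · exact card_biUnion_closedNbhd_le fun v _ => Nat.lt_succ_of_le (degree_le_maxDeg v)
  · refine (card_biUnion_closedNbhd_le (m := k) fun v hv => ?_).trans (Nat.mul_le_mul_right k ?_)
    · have := mem_midSet.1 (mem_of_mem_filter v hv)
      omega
    · exact (card_initialSegment _ _).trans_le (min_le_right _ _)

theorem HasBColoring.le_maxDeg_add_one (h : HasBColoring G k) : k ≤ maxDeg G + 1 := by
  rcases Nat.eq_zero_or_pos k with rfl | hk
  · exact Nat.zero_le _
  obtain ⟨c, hc⟩ := h
  obtain ⟨x, -, hx⟩ := isBColoring_iff.1 hc ⟨0, hk⟩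
  have hdeg : k ≤ G.degree x + 1 := by simpa using hx.card_le_degree_add_one
  exact hdeg.trans (Nat.succ_le_succ (degree_le_maxDeg x))

theorem hasBColoring_iff_of_maxDeg_eq_zero (hΔ : maxDeg G = 0) :
    HasBColoring G k ↔ k = min (Fintype.card V) 1 := by
  have hadj : ∀ u v, ¬ G.Adj u v := fun u v huv => by
    have hpos := (G.degree_pos_iff_exists_adj u).2 ⟨v, huv⟩
    have hle := degree_le_maxDeg (G := G) u
    omega
  have hk : HasBColoring G k → k ≤ 1 := fun h => by simpa [hΔ] using h.le_maxDeg_add_one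
  rcases isEmpty_or_nonempty V with hV | hV
  · rw [Fintype.card_eq_zero, Nat.zero_min]
    refine ⟨fun ⟨c, hc⟩ => ?_, ?_⟩
    · by_contra hk0
      exact hV.false (hc ⟨0, Nat.pos_of_ne_zero hk0⟩).choose
    · rintro rfl
      exact ⟨SimpleGraph.Coloring.mk isEmptyElim fun {v} => isEmptyElim v, fun i => i.elim0⟩
  · obtain ⟨v⟩ := id hV
    rw [min_eq_right Fintype.card_pos]
    refine ⟨fun h => (hk h).antisymm ?_, ?_⟩
    · obtain ⟨c, -⟩ := h
      exact (c v).pos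
    · rintro rfl
      exact ⟨SimpleGraph.Coloring.mk (fun _ => 0) fun {u w} huw => (hadj u w huw).elim, fun i =>
        ⟨v, Subsingleton.elim _ _, fun j hj => (hj (Subsingleton.elim j i)).elim⟩⟩

end Coloring

namespace Ram

/-! ### Programs with counting loops -/

def State.setReg (s : State) (r x : ℕ) : State := { s with reg := Function.update s.reg r x }

@[simp]
theorem State.setReg_reg_self (s : State) (r x : ℕ) : (s.setReg r x).reg r = x :=
  Function.update_self ..

theorem State.setReg_reg_of_ne (s : State) {r r' : ℕ} (h : r' ≠ r) (x : ℕ) :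
    (s.setReg r x).reg r' = s.reg r' :=
  Function.update_of_ne h ..

/-- Programs in which all loops are counting loops, so that they always halt. In `forLT i r p`,
register `i` counts from `0` up to the value of register `r`. -/
inductive ForProg where
  | set (r : ℕ) (e : Expr)
  | put (a : ℕ) (i e : Expr)
  | emit (e : Expr)
  | seq (p q : ForProg)
  | when (e : Expr) (p : ForProg)
  | forLT (i r : ℕ) (p : ForProg)

namespace ForProg

def compile : ForProg → Prog
  | set r e => .set r e
  | put a i e => .put a i e
  | emit e => .emit e
  | seq p q => .seq p.compile q.compile
  | when e p => .ite e p.compile .skip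
  | forLT i r p => .seq (.set i (.const 0)) (.loop (.sub (.reg r) (.reg i))
      (.seq p.compile (.set i (.add (.reg i) (.const 1)))))

/-- The effect of a program; that of a loop is correct for loops that do not write to the registers
that control them. -/
def run : ForProg → State → State
  | set r e, s => s.setReg r (e.eval s)
  | put a i e, s =>
    { s with arr := Function.update s.arr a (Function.update (s.arr a) (i.eval s) (e.eval s)) }
  | emit e, s => { s with out := s.out ++ [e.eval s] }
  | seq p q, s => q.run (p.run s)
  | when e p, s => if e.eval s ≠ 0 then p.run s else s
  | forLT i r p, s => (fun s' => (p.run s').setReg i (s'.reg i + 1))^[s.reg r] (s.setReg i 0)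

/-- The registers that a program assigns to. -/
def writes : ForProg → Finset ℕ
  | set r _ => {r}
  | put _ _ _ => ∅
  | emit _ => ∅
  | seq p q => p.writes ∪ q.writes
  | when _ p => p.writes
  | forLT i _ p => insert i p.writes

/-- The arrays that a program assigns to. -/
def arrays : ForProg → Finset ℕ
  | set _ _ => ∅
  | put a _ _ => {a}
  | emit _ => ∅
  | seq p q => p.arrays ∪ q.arrays
  | when _ p => p.arrays
  | forLT _ _ p => p.arrays

/-- Whether a program can write to the output tape. -/
def emits : ForProg → Bool
  | set _ _ => false
  | put _ _ _ => false
  | emit _ => true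
  | seq p q => p.emits || q.emits
  | when _ p => p.emits
  | forLT _ _ p => p.emits

/-- The registers that bound the loops of a program. -/
def bounds : ForProg → Finset ℕ
  | set _ _ => ∅
  | put _ _ _ => ∅
  | emit _ => ∅
  | seq p q => p.bounds ∪ q.bounds
  | when _ p => p.bounds
  | forLT _ r p => insert r p.bounds

/-- No loop body assigns to its loop counter. -/
def counts : ForProg → Bool
  | set _ _ => true
  | put _ _ _ => true
  | emit _ => true
  | seq p q => p.counts && q.counts
  | when _ p => p.counts
  | forLT i _ p => decide (i ∉ p.writes) && p.counts

/-- A bound on the running time in terms of a bound on the registers `bounds`. -/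
noncomputable def cost : ForProg → Polynomial ℕ
  | set _ e => .C (e.cost + 1)
  | put _ i e => .C (i.cost + e.cost + 1)
  | emit e => .C (e.cost + 1)
  | seq p q => p.cost + q.cost
  | when e p => .C (e.cost + 2) + p.cost
  | forLT _ _ p => .X * (p.cost + .C 8) + .C 6

/-- `s'` differs from `s` only where `p` may write. -/
structure Frame (p : ForProg) (s s' : State) : Prop where
  reg : ∀ r ∉ p.writes, s'.reg r = s.reg r
  arr : ∀ a ∉ p.arrays, s'.arr a = s.arr a
  out : p.emits = false → s'.out = s.out

theorem Frame.refl (p : ForProg) (s : State) : Frame p s s :=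
  ⟨fun _ _ => rfl, fun _ _ => rfl, fun _ => rfl⟩

theorem Frame.trans {p : ForProg} {s₁ s₂ s₃ : State} (h₁ : Frame p s₁ s₂) (h₂ : Frame p s₂ s₃) :
    Frame p s₁ s₃ :=
  ⟨fun r hr => (h₂.reg r hr).trans (h₁.reg r hr), fun a ha => (h₂.arr a ha).trans (h₁.arr a ha),
    fun ho => (h₂.out ho).trans (h₁.out ho)⟩

theorem Frame.mono {p q : ForProg} {s s' : State} (h : Frame p s s') (hw : p.writes ⊆ q.writes)
    (ha : p.arrays ⊆ q.arrays) (ho : q.emits = false → p.emits = false) : Frame q s s' :=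
  ⟨fun r hr => h.reg r fun h' => hr (hw h'), fun a ha' => h.arr a fun h' => ha' (ha h'),
    fun ho' => h.out (ho ho')⟩

theorem Frame.setReg {p : ForProg} {s s' : State} (h : Frame p s s') {r : ℕ} (hr : r ∈ p.writes)
    (x : ℕ) : Frame p s (s'.setReg r x) :=
  ⟨fun r' hr' => (s'.setReg_reg_of_ne (ne_of_mem_of_not_mem hr hr').symm x).trans (h.reg r' hr'),
    h.arr, h.out⟩

theorem frame_run (p : ForProg) (s : State) : Frame p s (p.run s) := by
  induction p generalizing s with
  | set r e => exact (Frame.refl _ s).setReg (Finset.mem_singleton_self r) _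
  | put a i e =>
    exact ⟨fun _ _ => rfl, fun b hb => Function.update_of_ne (by simpa [arrays] using hb) _ _,
      fun _ => rfl⟩
  | emit e => exact ⟨fun _ _ => rfl, fun _ _ => rfl, by simp [emits]⟩
  | seq p q hp hq =>
    refine Frame.trans (s₂ := p.run s) ((hp s).mono Finset.subset_union_left
      Finset.subset_union_left fun h => ?_) ((hq _).mono Finset.subset_union_right
      Finset.subset_union_right fun h => ?_) <;> simp_all [emits]
  | when e p hp =>
    rw [run]
    split_ifs
    · exact (hp s).mono subset_rfl subset_rfl id
    · exact Frame.refl _ s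
  | forLT i r p hp =>
    have hi : i ∈ (forLT i r p).writes := Finset.mem_insert_self i _
    refine Function.Iterate.rec (Frame (forLT i r p) s) ((Frame.refl _ s).setReg hi 0)
      (fun s' hs' => ?_) (s.reg r)
    exact (hs'.trans ((hp s').mono (Finset.subset_insert i _) subset_rfl id)).setReg hi _

theorem exec_loop {i r c : ℕ} {p : ForProg} (hi : i ∉ p.writes) (hr : r ∉ p.writes) (hir : r ≠ i)
    (P : State → Prop) (hP : ∀ s, P s → P ((p.run s).setReg i (s.reg i + 1)))
    (hp : ∀ s, P s → ∃ t ≤ c, Exec p.compile s t (p.run s)) (m : ℕ) (s : State) (hs : P s)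
    (hm : s.reg i + m = s.reg r) :
    ∃ t ≤ m * (c + 8) + 4, Exec (.loop (.sub (.reg r) (.reg i))
      (.seq p.compile (.set i (.add (.reg i) (.const 1))))) s t
      ((fun s' => (p.run s').setReg i (s'.reg i + 1))^[m] s) := by
  induction m generalizing s with
  | zero => exact ⟨4, by omega, .loopDone (by simp only [Expr.eval]; omega)⟩
  | succ m ih =>
    obtain ⟨t, ht, hexec⟩ := hp s hs
    have hfr := frame_run p s
    obtain ⟨t', ht', hloop⟩ := ih _ (hP s hs) (by
      rw [State.setReg_reg_self, State.setReg_reg_of_ne _ hir, hfr.reg r hr]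
      omega)
    have hincr : Exec (.set i (.add (.reg i) (.const 1))) (p.run s) 4
        ((p.run s).setReg i (s.reg i + 1)) := by
      rw [← hfr.reg i hi]
      exact .set _ _ _
    refine ⟨_, ?_, .loopStep (by simp only [Expr.eval]; omega) (.seq hexec hincr) hloop⟩
    simp only [Expr.cost]
    rw [add_one_mul]
    omega

theorem exec_compile (p : ForProg) {N : ℕ} (s : State) (hp : p.counts = true)
    (hdisj : Disjoint p.bounds p.writes) (hN : ∀ r ∈ p.bounds, s.reg r ≤ N) :
    ∃ t ≤ p.cost.eval N, Exec p.compile s t (p.run s) := by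
  induction p generalizing s with
  | set r e => exact ⟨_, by simp [cost], .set s r e⟩
  | put a i e => exact ⟨_, by simp [cost], .put s a i e⟩
  | emit e => exact ⟨_, by simp [cost], .emit s e⟩
  | seq p q ihp ihq =>
    simp only [counts, Bool.and_eq_true, bounds, writes, Finset.disjoint_union_left,
      Finset.disjoint_union_right, Finset.mem_union] at hp hdisj hN
    obtain ⟨t, ht, hexec⟩ := ihp s hp.1 hdisj.1.1 fun r hr => hN r (Or.inl hr)
    obtain ⟨t', ht', hexec'⟩ := ihq (p.run s) hp.2 hdisj.2.2 fun r hr => by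
      rw [(frame_run p s).reg r (Finset.disjoint_left.1 hdisj.1.2 hr)]
      exact hN r (Or.inr hr)
    exact ⟨t + t', by simpa [cost] using add_le_add ht ht', hexec.seq hexec'⟩
  | when e p ih =>
    rw [run]
    split_ifs with he
    · obtain ⟨t, ht, hexec⟩ := ih s hp hdisj hN
      exact ⟨_, by simpa [cost] using by omega, .iteTrue he hexec⟩
    · exact ⟨_, by simpa [cost] using by omega, .iteFalse (not_not.1 he) (.skip s)⟩
  | forLT i r p ih =>
    simp only [counts, Bool.and_eq_true, decide_eq_true_eq, bounds, writes,
      Finset.disjoint_insert_left, Finset.disjoint_insert_right, Finset.mem_insert, not_or]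
      at hp hdisj hN
    obtain ⟨⟨hir, hip⟩, hrp, hdisj⟩ := hdisj
    have hri : r ≠ i := Ne.symm hir
    obtain ⟨t, ht, hloop⟩ := exec_loop (c := p.cost.eval N) hp.1 hrp hri
      (fun s' => ∀ b ∈ p.bounds, s'.reg b ≤ N)
      (fun s' hs' b hb => by
        rw [State.setReg_reg_of_ne _ (ne_of_mem_of_not_mem hb hip),
          (frame_run p s').reg b (Finset.disjoint_left.1 hdisj hb)]
        exact hs' b hb)
      (fun s' hs' => ih s' hp.2 hdisj hs') (s.reg r) (s.setReg i 0)
      (fun b hb => by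
        rw [State.setReg_reg_of_ne _ (ne_of_mem_of_not_mem hb hip)]
        exact hN b (Or.inr hb))
      (by rw [State.setReg_reg_self, State.setReg_reg_of_ne _ hri, Nat.zero_add])
    refine ⟨2 + t, ?_, .seq (.set s i (.const 0)) hloop⟩
    have hmul := Nat.mul_le_mul_right (p.cost.eval N + 8) (hN r (Or.inl rfl))
    simp only [cost, Polynomial.eval_add, Polynomial.eval_mul, Polynomial.eval_X,
      Polynomial.eval_C]
    omega

/-- Here `l` lists the values that the loop counter has run through. -/
theorem run_forLT {i r m : ℕ} {p : ForProg} {s : State} (hm : s.reg r = m)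
    (Inv : List (Fin m) → State → Prop) (h0 : Inv [] (s.setReg i 0))
    (hstep : ∀ l (u : Fin m) s', Frame (forLT i r p) s s' → s'.reg i = u → Inv l s' →
      Inv (l ++ [u]) ((p.run s').setReg i (u + 1))) :
    Inv (List.finRange m) ((forLT i r p).run s) := by
  subst hm
  have hwrites : i ∈ (forLT i r p).writes := Finset.mem_insert_self i _
  suffices key : ∀ j ≤ s.reg r,
      let s' := (fun s' => (p.run s').setReg i (s'.reg i + 1))^[j] (s.setReg i 0)
      Frame (forLT i r p) s s' ∧ s'.reg i = j ∧ Inv ((List.finRange (s.reg r)).take j) s' by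
    have := (key _ le_rfl).2.2
    rwa [List.take_of_length_le (by simp)] at this
  intro j hj
  induction j with
  | zero => exact ⟨(Frame.refl _ s).setReg hwrites 0, s.setReg_reg_self i 0, h0⟩
  | succ j ih =>
    obtain ⟨hframe, hreg, hinv⟩ := ih (by omega)
    have hj' : j < (List.finRange (s.reg r)).length := by simpa using hj
    rw [Function.iterate_succ_apply', List.take_succ_eq_append_getElem hj', List.getElem_finRange]
    refine ⟨(hframe.trans ((frame_run p _).mono (Finset.subset_insert i _) subset_rfl id)).setReg
      hwrites _, by rw [State.setReg_reg_self, hreg], ?_⟩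
    rw [hreg]
    exact hstep _ ⟨j, hj⟩ _ hframe hreg hinv

section Accumulation

variable {d i r m : ℕ} {s : State}

/-- Replaces register `d` by the value of `e`, for all values of the counter `i` below register `r`,
starting with `d = 0`. -/
def foldLoop (d i r : ℕ) (e : Expr) : ForProg :=
  seq (set d (.const 0)) (forLT i r (set d e))

theorem run_foldLoop {e : Expr} (hdi : d ≠ i) (hdr : d ≠ r) (hm : s.reg r = m)
    (g : ℕ → Fin m → ℕ) (he : ∀ (u : Fin m) s', Frame (foldLoop d i r e) s s' → s'.reg i = u →
      e.eval s' = g (s'.reg d) u) :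
    ((foldLoop d i r e).run s).reg d = (List.finRange m).foldl g 0 := by
  have hset : Frame (foldLoop d i r e) s (s.setReg d 0) :=
    (Frame.refl _ s).setReg (Finset.mem_union_left _ (Finset.mem_singleton_self d)) 0
  refine run_forLT (s := s.setReg d 0) (by rw [State.setReg_reg_of_ne _ hdr.symm, hm])
    (fun l s' => s'.reg d = l.foldl g 0) ?_ fun l u s' hframe hu hinv => ?_
  · rw [State.setReg_reg_of_ne _ hdi, State.setReg_reg_self, List.foldl_nil]
  · rw [State.setReg_reg_of_ne _ hdi, List.foldl_append, ← hinv, run, State.setReg_reg_self]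
    exact he u s' (hset.trans (hframe.mono Finset.subset_union_right Finset.subset_union_right
      (by simp [foldLoop, emits]))) hu

/-- Sets register `d` to the sum of the values of `e`. -/
def sumLoop (d i r : ℕ) (e : Expr) : ForProg := foldLoop d i r (.add (.reg d) e)

theorem run_sumLoop {e : Expr} (hdi : d ≠ i) (hdr : d ≠ r) (hm : s.reg r = m) (f : Fin m → ℕ)
    (he : ∀ (u : Fin m) s', Frame (sumLoop d i r e) s s' → s'.reg i = u → e.eval s' = f u) :
    ((sumLoop d i r e).run s).reg d = ∑ u, f u := by
  rw [sumLoop, run_foldLoop hdi hdr hm (fun x u => x + f u)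
    fun u s' hframe hu => congrArg (s'.reg d + ·) (he u s' hframe hu), Fin.sum_univ_def,
    List.sum_eq_foldl, List.foldl_map]

theorem run_sumLoop_const {x : ℕ} {e : Expr} (hdi : d ≠ i) (hdr : d ≠ r) (hm : s.reg r = m)
    (he : ∀ s', Frame (sumLoop d i r e) s s' → e.eval s' = x) :
    ((sumLoop d i r e).run s).reg d = m * x := by
  rw [run_sumLoop hdi hdr hm (fun _ => x) fun _ s' hs' _ => he s' hs', Finset.sum_const,
    Finset.card_univ, Fintype.card_fin, smul_eq_mul]

/-- Sets register `d` to the maximum of the values of `e`. -/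
def maxLoop (d i r : ℕ) (e : Expr) : ForProg :=
  foldLoop d i r (.add (.reg d) (.sub e (.reg d)))

theorem run_maxLoop {e : Expr} (hdi : d ≠ i) (hdr : d ≠ r) (hm : s.reg r = m) (f : Fin m → ℕ)
    (he : ∀ (u : Fin m) s', Frame (maxLoop d i r e) s s' → s'.reg i = u → e.eval s' = f u) :
    ((maxLoop d i r e).run s).reg d = Finset.univ.sup f := by
  rw [maxLoop, run_foldLoop hdi hdr hm (fun x u => x + (f u - x))
    fun u s' hframe hu => congrArg (fun y => s'.reg d + (y - s'.reg d)) (he u s' hframe hu),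
    ← List.toFinset_finRange]
  induction List.finRange m using List.reverseRecOn with
  | nil => rfl
  | append_singleton l u ih =>
    rw [List.foldl_append, ih, List.toFinset_append, Finset.sup_union]
    simp [add_tsub_eq_max]

/-- Appends the value of `e'` to the output tape whenever the value of `e` is nonzero. -/
def emitLoop (i r : ℕ) (e e' : Expr) : ForProg := forLT i r (when e (emit e'))

theorem run_emitLoop {e e' : Expr} (hm : s.reg r = m) (P : Fin m → Prop) [DecidablePred P]
    (f : Fin m → ℕ)
    (he : ∀ (u : Fin m) s', Frame (emitLoop i r e e') s s' → s'.reg i = u →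
      (e.eval s' ≠ 0 ↔ P u) ∧ e'.eval s' = f u) :
    ((emitLoop i r e e').run s).out = s.out ++ ((List.finRange m).filter P).map f := by
  refine run_forLT hm (fun l s' => s'.out = s.out ++ (l.filter P).map f) (List.append_nil _).symm
    fun l u s' hframe hu hinv => ?_
  obtain ⟨hP, hf⟩ := he u s' hframe hu
  by_cases h : P u <;> simp [run, h, hP, hf, hinv, State.setReg]

end Accumulation

end ForProg

/-! ### Boolean expressions -/

/-- The value of `e` is the truth value of `P`. -/
def Expr.Decides (e : Expr) (s : State) (P : Prop) [Decidable P] : Prop :=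
  e.eval s = if P then 1 else 0

namespace Expr

variable {a b : Expr} {s : State} {P Q : Prop} [Decidable P] [Decidable Q]

theorem Decides.eval_ne_zero_iff (h : a.Decides s P) : a.eval s ≠ 0 ↔ P := by
  rw [h]
  split_ifs <;> simpa

theorem Decides.congr (h : a.Decides s P) (hPQ : P ↔ Q) : a.Decides s Q :=
  h.trans (if_congr hPQ rfl rfl)

/-- Truth value of `a ≤ b`. -/
def le (a b : Expr) : Expr := .sub (.const 1) (.sub a b)

theorem decides_le (a b : Expr) (s : State) : (le a b).Decides s (a.eval s ≤ b.eval s) := by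
  simp only [Decides, le, eval]
  split_ifs <;> omega

/-- Conjunction of truth values. -/
def and (a b : Expr) : Expr := .sub (.add a b) (.const 1)

theorem Decides.and (ha : a.Decides s P) (hb : b.Decides s Q) : (a.and b).Decides s (P ∧ Q) := by
  simp only [Decides, Expr.and, eval] at *
  rw [ha, hb]
  split_ifs <;> simp_all

/-- Disjunction of truth values. -/
def or (a b : Expr) : Expr := .sub (.const 1) (.sub (.const 1) (.add a b))

theorem Decides.or (ha : a.Decides s P) (hb : b.Decides s Q) : (a.or b).Decides s (P ∨ Q) := by
  simp only [Decides, Expr.or, eval] at *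
  rw [ha, hb]
  split_ifs <;> simp_all

/-- Truth value of `a = b`. -/
def eq (a b : Expr) : Expr := (le a b).and (le b a)

theorem decides_eq (a b : Expr) (s : State) : (eq a b).Decides s (a.eval s = b.eval s) :=
  ((decides_le a b s).and (decides_le b a s)).congr le_antisymm_iff.symm

end Expr

/-! ### Loops over the adjacency matrix -/

abbrev nReg : ℕ := 1

abbrev kReg : ℕ := 2

/-- Position of the current matrix row in the input. -/
abbrev rowReg : ℕ := 3

/-- Index of the current matrix row. -/
abbrev uReg : ℕ := 4

/-- Index of the current matrix column. -/
abbrev vReg : ℕ := 5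

/-- Sum over the current matrix row. -/
abbrev accReg : ℕ := 6

namespace ForProg

open scoped Finset

variable {m : ℕ} {s : State} {p : ForProg}

/-- Runs `p` for every row of the adjacency matrix. -/
def scanRows (p : ForProg) : ForProg :=
  seq (set rowReg (.const 2))
    (forLT uReg nReg (seq p (set rowReg (.add (.reg rowReg) (.reg nReg)))))

theorem run_scanRows (hm : s.reg nReg = m) (hn : nReg ∉ p.writes) (hrow : rowReg ∉ p.writes)
    (Inv : List (Fin m) → (ℕ → ℕ → ℕ) → List ℕ → Prop) (h0 : Inv [] s.arr s.out)
    (hstep : ∀ l (u : Fin m) s', Frame (scanRows p) s s' → s'.reg uReg = u →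
      s'.reg rowReg = 2 + u * m → Inv l s'.arr s'.out →
      Inv (l ++ [u]) (p.run s').arr (p.run s').out) :
    Inv (List.finRange m) ((scanRows p).run s).arr ((scanRows p).run s).out := by
  have hset : Frame (scanRows p) s (s.setReg rowReg 2) :=
    (Frame.refl _ s).setReg (Finset.mem_union_left _ (Finset.mem_singleton_self _)) 2
  refine (run_forLT (s := s.setReg rowReg 2) (by rw [State.setReg_reg_of_ne _ (by decide), hm])
    (fun l s' => s'.reg rowReg = 2 + s'.reg uReg * m ∧ Inv l s'.arr s'.out) ⟨?_, h0⟩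
    fun l u s' hframe hu ⟨hrow', hinv⟩ => ?_).2
  · rw [State.setReg_reg_of_ne _ (by decide), State.setReg_reg_self, State.setReg_reg_self,
      Nat.zero_mul]
  have hframe' : Frame (scanRows p) s s' := hset.trans (hframe.mono Finset.subset_union_right
    Finset.subset_union_right (by simp [scanRows, emits]))
  have hn' : s'.reg nReg = m := by
    rw [hframe'.reg _ (by simp [scanRows, writes, hn]), hm]
  refine ⟨?_, hstep l u s' hframe' hu (hu ▸ hrow') hinv⟩
  rw [State.setReg_reg_of_ne _ (by decide), State.setReg_reg_self, run, run,
    State.setReg_reg_self, Expr.eval, Expr.eval, Expr.eval, (frame_run p s').reg _ hrow,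
    (frame_run p s').reg _ hn, hrow', hn', hu]
  ring

/-- Stores in `arr a u` the number of columns `v` for which `e` has value `1`. -/
def countRows (a : ℕ) (e : Expr) : ForProg :=
  scanRows (seq (sumLoop accReg vReg nReg e) (put a (.reg uReg) (.reg accReg)))

theorem run_countRows {a : ℕ} {e : Expr} (hm : s.reg nReg = m) (P : Fin m → Fin m → Prop)
    [∀ u, DecidablePred (P u)]
    (he : ∀ (u v : Fin m) s', Frame (countRows a e) s s' → s'.reg uReg = u →
      s'.reg rowReg = 2 + u * m → s'.reg vReg = v → e.Decides s' (P u v)) (u : Fin m) :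
    ((countRows a e).run s).arr a u = #{v | P u v} := by
  refine run_scanRows hm (by simp [writes, sumLoop, foldLoop]) (by simp [writes, sumLoop, foldLoop])
    (fun l A _ => ∀ u ∈ l, A a u = #{v | P u v}) (by simp)
    (fun l u s' hframe hu hrow hinv => ?_) u (List.mem_finRange u)
  have hm' : s'.reg nReg = m := by
    rw [hframe.reg _ (by simp [scanRows, writes, sumLoop, foldLoop]), hm]
  have hcount : ((sumLoop accReg vReg nReg e).run s').reg accReg = #{v | P u v} := by
    rw [Finset.card_filter]
    refine run_sumLoop (by decide) (by decide) hm' _ fun v s'' hs'' hv =>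
      he u v s'' (hframe.trans (hs''.mono ?_ ?_ ?_))
        ((hs''.reg _ (by simp [writes, sumLoop, foldLoop])).trans hu)
        ((hs''.reg _ (by simp [writes, sumLoop, foldLoop])).trans hrow) hv
    · simp [scanRows, writes, sumLoop, foldLoop, Finset.insert_subset_iff]
    · simp [scanRows, arrays, sumLoop, foldLoop]
    · simp [scanRows, emits, sumLoop, foldLoop]
  have hsum := frame_run (sumLoop accReg vReg nReg e) s'
  intro w hw
  rw [run, run, hsum.arr a (Finset.notMem_empty a), Expr.eval, Expr.eval, hcount,
    hsum.reg uReg (by simp [writes, sumLoop, foldLoop]), hu]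
  change (Function.update _ a _ : ℕ → ℕ → ℕ) a w = _
  rw [Function.update_self]
  by_cases hwu : w = u
  · rw [hwu, Function.update_self]
  · rw [Function.update_of_ne (by simpa [Fin.ext_iff] using hwu)]
    exact hinv w ((List.mem_append.1 hw).resolve_right (by simpa using hwu))

/-- Appends to the output tape the entries of the adjacency matrix in the rows and columns that are
marked in array `a`. -/
def emitSubmatrix (a : ℕ) : ForProg :=
  scanRows (when (.get a (.reg uReg)) (emitLoop vReg nReg (.get a (.reg vReg))
    (.get 0 (.add (.reg rowReg) (.reg vReg)))))

theorem run_emitSubmatrix {a : ℕ} (hm : s.reg nReg = m) (P : Fin m → Prop) [DecidablePred P]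
    (hP : ∀ u : Fin m, s.arr a u ≠ 0 ↔ P u) (f : Fin m → Fin m → ℕ)
    (hf : ∀ u v : Fin m, s.arr 0 (2 + u * m + v) = f u v) :
    ((emitSubmatrix a).run s).out = s.out ++
      ((List.finRange m).filter P).flatMap fun u => ((List.finRange m).filter P).map (f u) := by
  refine run_scanRows hm (by simp [writes, emitLoop]) (by simp [writes, emitLoop])
    (fun l _ O => O = s.out ++ (l.filter P).flatMap fun u => ((List.finRange m).filter P).map (f u))
    (by simp) fun l u s' hframe hu hrow hinv => ?_
  have harr : s'.arr = s.arr :=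
    funext fun b => hframe.arr b (by simp [scanRows, arrays, emitLoop])
  have hm' : s'.reg nReg = m := by
    rw [hframe.reg _ (by simp [scanRows, writes, emitLoop]), hm]
  rw [run, Expr.eval, Expr.eval, harr, hu]
  by_cases h : P u
  · rw [if_pos ((hP u).2 h), run_emitLoop hm' P (f u) fun v s'' hs'' hv => ?_]
    · simp [h, hinv]
    · have harr' : s''.arr = s.arr :=
        (funext fun b => hs''.arr b (by simp [arrays, emitLoop])).trans harr
      simp only [Expr.eval, harr', hv, hs''.reg rowReg (by simp [writes, emitLoop]), hrow]
      exact ⟨hP v, hf u v⟩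
  · rw [if_neg (mt (hP u).1 h)]
    simp [h, hinv]

end ForProg
end Ram

/-! ### A program that computes the kernel -/

theorem getD_flatMap {α β : Type*} {n : ℕ} (g : α → List β) (d : β) (hg : ∀ x, (g x).length = n)
    (L : List α) {u v : ℕ} (hu : u < L.length) (hv : v < n) :
    (L.flatMap g).getD (u * n + v) d = (g L[u]).getD v d := by
  induction L generalizing u with
  | nil => simp at hu
  | cons x L ih =>
    rw [List.flatMap_cons]
    cases u with
    | zero =>
      rw [List.getD_append _ _ _ _ (by rw [hg]; omega)]
      simp
    | succ u =>
      rw [List.getD_append_right _ _ _ _ (by rw [hg, add_mul]; omega), hg,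
        show (u + 1) * n + v - n = u * n + v by rw [add_mul]; omega]
      exact ih (by simpa using hu)

theorem size_le_self (x : ℕ) : Nat.size x ≤ x := Nat.size_le.2 Nat.lt_two_pow_self

theorem bitLength_le_of_forall_le_one {w : List ℕ} (h : ∀ x ∈ w, x ≤ 1) :
    bitLength w ≤ w.length * 2 := by
  simpa [bitLength] using List.sum_le_card_nsmul (w.map fun a => Nat.size a + 1) 2
    (by simpa using fun x hx => (size_le_self x).trans (h x hx))

namespace BInstance

open Classical Ram Ram.ForProg Finset

abbrev degArr : ℕ := 1

/-- Array with the number of smaller vertices of degree `k - 1`. -/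
abbrev rankArr : ℕ := 2

/-- Array that is nonzero on the vertices of the kernel. -/
abbrev markArr : ℕ := 3

abbrev maxDegReg : ℕ := 7

/-- Number of vertices of degree at least `k`. -/
abbrev highReg : ℕ := 8

abbrev squareReg : ℕ := 9

abbrev cubeReg : ℕ := 10

/-- Product of `Δ` and the number of vertices of degree at least `k`. -/
abbrev productReg : ℕ := 11

abbrev boundReg : ℕ := 12

/-- Number of vertices of the kernel. -/
abbrev sizeReg : ℕ := 13

variable {I : BInstance} {s s' : State} {p : ForProg}

/-- The instance `I` has been read. -/
structure HasInput (I : BInstance) (s : State) : Prop where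
  reg_n : s.reg nReg = I.n
  reg_k : s.reg kReg = I.k
  arr_adj : ∀ u v : Fin I.n, s.arr 0 (2 + u * I.n + v) = if I.G.Adj u v then 1 else 0

theorem HasInput.of_frame (h : HasInput I s) (hf : Frame p s s')
    (hn : nReg ∉ p.writes := by decide) (hk : kReg ∉ p.writes := by decide)
    (ha : 0 ∉ p.arrays := by decide) : HasInput I s' :=
  ⟨(hf.reg _ hn).trans h.reg_n, (hf.reg _ hk).trans h.reg_k,
    fun u v => (congrFun (hf.arr _ ha) _).trans (h.arr_adj u v)⟩

/-- Truth value of the adjacency of the vertices in registers `uReg` and `vReg`. -/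
def adjExpr : Expr := .get 0 (.add (.reg rowReg) (.reg vReg))

theorem HasInput.decides_adjExpr (h : HasInput I s) {u v : Fin I.n}
    (hrow : s.reg rowReg = 2 + u * I.n) (hv : s.reg vReg = v) :
    adjExpr.Decides s (I.G.Adj u v) := by
  rw [Expr.Decides, ← h.arr_adj u v, ← hrow, ← hv]
  rfl

/-- Reads the number of vertices and the number of colors. -/
def loadProg : ForProg := seq (set nReg (.get 0 (.const 0))) (set kReg (.get 0 (.const 1)))

/-- Additionally, the degrees of the vertices are known. -/
structure HasDegrees (I : BInstance) (s : State) : Prop extends HasInput I s where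
  arr_deg : ∀ u : Fin I.n, s.arr degArr u = I.G.degree u

theorem HasDegrees.of_frame (h : HasDegrees I s) (hf : Frame p s s')
    (hn : nReg ∉ p.writes := by decide) (hk : kReg ∉ p.writes := by decide)
    (ha : 0 ∉ p.arrays := by decide) (hd : degArr ∉ p.arrays := by decide) : HasDegrees I s' :=
  ⟨h.toHasInput.of_frame hf hn hk ha, fun u => (congrFun (hf.arr _ hd) _).trans (h.arr_deg u)⟩

def degreeProg : ForProg := countRows degArr adjExpr

theorem HasInput.hasDegrees_degreeProg (h : HasInput I s) : HasDegrees I (degreeProg.run s) := by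
  refine ⟨h.of_frame (frame_run degreeProg s), fun u => ?_⟩
  rw [degreeProg, run_countRows h.reg_n I.G.Adj fun u v s' hs' _ hrow hv =>
    (h.of_frame hs').decides_adjExpr hrow hv, ← SimpleGraph.card_neighborFinset_eq_degree,
    SimpleGraph.neighborFinset_eq_filter]

/-- Truth value of `k ≤ deg i`. -/
def highExpr (i : ℕ) : Expr := .le (.reg kReg) (.get degArr (.reg i))

theorem HasDegrees.decides_highExpr (h : HasDegrees I s) {i : ℕ} {u : Fin I.n}
    (hu : s.reg i = u) : (highExpr i).Decides s (u ∈ highSet I.G I.k) := by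
  refine (Expr.decides_le _ _ s).congr ?_
  rw [Expr.eval, Expr.eval, Expr.eval, h.reg_k, hu, h.arr_deg, mem_highSet]

/-- Truth value of `deg i + 1 = k`. -/
def midExpr (i : ℕ) : Expr := .eq (.add (.get degArr (.reg i)) (.const 1)) (.reg kReg)

theorem HasDegrees.decides_midExpr (h : HasDegrees I s) {i : ℕ} {u : Fin I.n}
    (hu : s.reg i = u) : (midExpr i).Decides s (u ∈ midSet I.G I.k) := by
  refine (Expr.decides_eq _ _ s).congr ?_
  simp only [Expr.eval, h.reg_k, hu, h.arr_deg, mem_midSet]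

/-- Additionally, the maximum degree and the number of vertices of large degree are known. -/
structure HasStats (I : BInstance) (s : State) : Prop extends HasDegrees I s where
  reg_maxDeg : s.reg maxDegReg = I.Δ
  reg_high : s.reg highReg = I.ell

/-- Computes the degrees, the maximum degree and the number of vertices of large degree. -/
def statsProg : ForProg :=
  seq degreeProg (seq (maxLoop maxDegReg uReg nReg (.get degArr (.reg uReg)))
    (sumLoop highReg uReg nReg (highExpr uReg)))

theorem HasInput.hasStats_statsProg (h : HasInput I s) : HasStats I (statsProg.run s) := by
  have hdeg := h.hasDegrees_degreeProg
  set s₁ := degreeProg.run s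
  have hmax : ((maxLoop maxDegReg uReg nReg (.get degArr (.reg uReg))).run s₁).reg maxDegReg =
      I.Δ := by
    rw [run_maxLoop (by decide) (by decide) hdeg.reg_n (fun u => I.G.degree u),
      sup_degree_eq_maxDeg]
    · rfl
    intro u s' hs' hu
    rw [Expr.eval, Expr.eval, hu, (hdeg.of_frame hs').arr_deg]
  have hdeg₂ := hdeg.of_frame (frame_run (maxLoop maxDegReg uReg nReg (.get degArr (.reg uReg))) s₁)
  set s₂ := (maxLoop maxDegReg uReg nReg (.get degArr (.reg uReg))).run s₁
  have hframe := frame_run (sumLoop highReg uReg nReg (highExpr uReg)) s₂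
  refine ⟨hdeg₂.of_frame hframe, (hframe.reg maxDegReg (by decide)).trans hmax, ?_⟩
  refine (run_sumLoop (by decide) (by decide) hdeg₂.reg_n _ fun u s' hs' hu =>
    (hdeg₂.of_frame hs').decides_highExpr hu).trans ?_
  rw [← card_filter, filter_mem_eq_inter, univ_inter, card_highSet]
  rfl

/-- Additionally, `scatterBound` is known. -/
structure HasBound (I : BInstance) (s : State) : Prop extends HasDegrees I s where
  reg_bound : s.reg boundReg = scatterBound I.G I.k

/-- Computes `scatterBound` by repeated addition. -/
def boundProg : ForProg :=
  seq (sumLoop squareReg vReg kReg (.reg kReg)) (seq (sumLoop cubeReg vReg kReg (.reg squareReg))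
    (seq (sumLoop productReg vReg highReg (.reg maxDegReg))
      (sumLoop boundReg vReg kReg (.add (.reg cubeReg) (.reg productReg)))))

theorem HasStats.hasBound_boundProg (h : HasStats I s) : HasBound I (boundProg.run s) := by
  refine ⟨h.toHasDegrees.of_frame (frame_run boundProg s), ?_⟩
  set s₁ := (sumLoop squareReg vReg kReg (.reg kReg)).run s
  set s₂ := (sumLoop cubeReg vReg kReg (.reg squareReg)).run s₁
  set s₃ := (sumLoop productReg vReg highReg (.reg maxDegReg)).run s₂
  have hframe₁ : Frame (sumLoop squareReg vReg kReg (.reg kReg)) s s₁ := frame_run _ s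
  have hframe₂ : Frame (sumLoop cubeReg vReg kReg (.reg squareReg)) s₁ s₂ := frame_run _ s₁
  have hframe₃ : Frame (sumLoop productReg vReg highReg (.reg maxDegReg)) s₂ s₃ := frame_run _ s₂
  have hk₁ : s₁.reg kReg = I.k := (hframe₁.reg _ (by decide)).trans h.reg_k
  have hk₂ : s₂.reg kReg = I.k := (hframe₂.reg _ (by decide)).trans hk₁
  have hk₃ : s₃.reg kReg = I.k := (hframe₃.reg _ (by decide)).trans hk₂
  have hsquare : s₁.reg squareReg = I.k * I.k :=
    run_sumLoop_const (by decide) (by decide) h.reg_k fun s' hs' =>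
      (hs'.reg _ (by decide)).trans h.reg_k
  have hcube : s₂.reg cubeReg = I.k * (I.k * I.k) :=
    run_sumLoop_const (by decide) (by decide) hk₁ fun s' hs' =>
      (hs'.reg _ (by decide)).trans hsquare
  have hhigh : s₂.reg highReg = I.ell :=
    (hframe₂.reg _ (by decide)).trans ((hframe₁.reg _ (by decide)).trans h.reg_high)
  have hmax : s₂.reg maxDegReg = I.Δ :=
    (hframe₂.reg _ (by decide)).trans ((hframe₁.reg _ (by decide)).trans h.reg_maxDeg)
  have hproduct : s₃.reg productReg = I.ell * I.Δ :=
    run_sumLoop_const (by decide) (by decide) hhigh fun s' hs' =>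
      (hs'.reg _ (by decide)).trans hmax
  refine (run_sumLoop_const (x := I.k * (I.k * I.k) + I.ell * I.Δ) (by decide) (by decide) hk₃
    fun s' hs' => ?_).trans (by rw [scatterBound, ← Δ, ← ell]; ring)
  rw [Expr.eval, Expr.eval, Expr.eval, hs'.reg cubeReg (by decide),
    hs'.reg productReg (by decide), hproduct, hframe₃.reg cubeReg (by decide), hcube]

/-- Additionally, the first `scatterBound` vertices of degree `k - 1` can be recognized. -/
structure HasRanks (I : BInstance) (s : State) : Prop extends HasBound I s where
  arr_rank : ∀ u : Fin I.n, s.arr rankArr u = #((midSet I.G I.k).filter (· < u))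

theorem HasRanks.of_frame (h : HasRanks I s) (hf : Frame p s s')
    (hn : nReg ∉ p.writes := by decide) (hk : kReg ∉ p.writes := by decide)
    (hb : boundReg ∉ p.writes := by decide) (ha : 0 ∉ p.arrays := by decide)
    (hd : degArr ∉ p.arrays := by decide) (hr : rankArr ∉ p.arrays := by decide) :
    HasRanks I s' :=
  ⟨⟨h.toHasDegrees.of_frame hf hn hk ha hd, (hf.reg _ hb).trans h.reg_bound⟩,
    fun u => (congrFun (hf.arr _ hr) _).trans (h.arr_rank u)⟩

/-- Counts for each vertex the smaller vertices of degree `k - 1`. -/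
def rankProg : ForProg :=
  countRows rankArr ((midExpr vReg).and (.le (.add (.reg vReg) (.const 1)) (.reg uReg)))

theorem HasBound.hasRanks_rankProg (h : HasBound I s) : HasRanks I (rankProg.run s) := by
  have hframe := frame_run rankProg s
  refine ⟨⟨h.toHasDegrees.of_frame hframe, (hframe.reg boundReg (by decide)).trans h.reg_bound⟩,
    fun u => ?_⟩
  rw [rankProg, run_countRows h.reg_n (fun u v => v ∈ midSet I.G I.k ∧ v < u)
    fun u v s' hs' hu _ hv => ((h.toHasDegrees.of_frame hs').decides_midExpr hv).and
      ((Expr.decides_le _ _ s').congr ?_)]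
  · simp only [filter_and, filter_mem_eq_inter, univ_inter, inter_filter, inter_univ]
  · rw [Expr.eval, Expr.eval, Expr.eval, Expr.eval, hv, hu, Nat.add_one_le_iff, Fin.lt_def]

/-- Truth value of membership of `i` in `coreSet`. -/
def coreExpr (i : ℕ) : Expr :=
  (highExpr i).or ((midExpr i).and
    (.le (.add (.get rankArr (.reg i)) (.const 1)) (.reg boundReg)))

theorem HasRanks.decides_coreExpr (h : HasRanks I s) {i : ℕ} {u : Fin I.n} (hu : s.reg i = u) :
    (coreExpr i).Decides s (u ∈ coreSet I.G I.k) := by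
  refine ((h.decides_highExpr hu).or ((h.decides_midExpr hu).and (Expr.decides_le _ _ s))).congr ?_
  simp only [Expr.eval, hu, h.arr_rank, h.reg_bound, Nat.add_one_le_iff, coreSet, initialSegment,
    mem_union, mem_filter]

/-- Additionally, the vertices of the kernel are marked. -/
structure HasMarks (I : BInstance) (s : State) : Prop extends HasInput I s where
  arr_mark : ∀ u : Fin I.n, s.arr markArr u ≠ 0 ↔ u ∈ kernelSet I.G I.k

theorem HasMarks.of_frame (h : HasMarks I s) (hf : Frame p s s')
    (hn : nReg ∉ p.writes := by decide) (hk : kReg ∉ p.writes := by decide)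
    (ha : 0 ∉ p.arrays := by decide) (hm : markArr ∉ p.arrays := by decide) : HasMarks I s' :=
  ⟨h.toHasInput.of_frame hf hn hk ha, fun u => by rw [hf.arr _ hm, h.arr_mark u]⟩

def markProg : ForProg :=
  countRows markArr ((coreExpr vReg).and ((Expr.eq (.reg uReg) (.reg vReg)).or adjExpr))

theorem HasRanks.hasMarks_markProg (h : HasRanks I s) : HasMarks I (markProg.run s) := by
  refine ⟨h.toHasInput.of_frame (frame_run markProg s), fun u => ?_⟩
  rw [markProg, run_countRows h.reg_n
    (fun u v => v ∈ coreSet I.G I.k ∧ u ∈ closedNbhd I.G v) fun u v s' hs' hu hrow hv =>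
      ((h.of_frame hs').decides_coreExpr hv).and (((Expr.decides_eq _ _ s').or
        ((h.toHasInput.of_frame hs').decides_adjExpr hrow hv)).congr ?_)]
  · simp [kernelSet, filter_eq_empty_iff]
  · rw [Expr.eval, Expr.eval, hu, hv, Fin.val_inj, mem_closedNbhd, I.G.adj_comm]

/-- The vertices of the kernel in increasing order. -/
noncomputable def kernelList (I : BInstance) : List (Fin I.n) :=
  (List.finRange I.n).filter (· ∈ kernelSet I.G I.k)

/-- The instance induced by the vertices of the kernel. -/
noncomputable def kernel (I : BInstance) : BInstance where
  n := I.kernelList.length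
  G := I.G.comap I.kernelList.get
  k := I.k

theorem length_kernelList (I : BInstance) : I.kernelList.length = #(kernelSet I.G I.k) := by
  rw [kernelList, ← List.toFinset_card_of_nodup ((List.nodup_finRange _).filter _)]
  congr 1
  ext
  simp

theorem encode_kernel (I : BInstance) :
    I.kernel.encode = #(kernelSet I.G I.k) :: I.k :: I.kernelList.flatMap fun u =>
      I.kernelList.map fun v => if I.G.Adj u v then 1 else 0 := by
  rw [← length_kernelList]
  refine congrArg (_ :: _ :: ·) ?_
  conv_rhs => rw [← List.map_get_finRange I.kernelList, List.flatMap_map]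
  simp only [List.map_map]
  rfl

/-- Outputs the number of vertices and the number of colors of the kernel, after the tag `2` of
reduced instances. -/
def headerProg : ForProg :=
  seq (sumLoop sizeReg uReg nReg (.le (.const 1) (.get markArr (.reg uReg))))
    (seq (emit (.const 2)) (seq (emit (.reg sizeReg)) (emit (.reg kReg))))

theorem HasMarks.out_headerProg (h : HasMarks I s) :
    (headerProg.run s).out = s.out ++ [2, #(kernelSet I.G I.k), I.k] := by
  set p := sumLoop sizeReg uReg nReg (.le (.const 1) (.get markArr (.reg uReg))) with hp
  have hframe : Frame p s (p.run s) := frame_run p s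
  have hsize : (p.run s).reg sizeReg = #(kernelSet I.G I.k) := by
    refine (run_sumLoop (by decide) (by decide) h.reg_n _ fun u s' hs' hu =>
      (Expr.decides_le _ _ s').congr (Q := u ∈ kernelSet I.G I.k) ?_).trans ?_
    · rw [← h.arr_mark, Nat.one_le_iff_ne_zero.symm, Expr.eval, Expr.eval, Expr.eval, hu,
        hs'.arr markArr (by decide)]
    · rw [← card_filter, filter_mem_eq_inter, univ_inter]
  rw [headerProg, ← hp]
  simp only [run, Expr.eval, hframe.out rfl, hsize, (h.of_frame hframe).reg_k, List.append_assoc,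
    List.cons_append, List.nil_append]

def outputProg : ForProg := seq headerProg (emitSubmatrix markArr)

theorem HasMarks.out_outputProg (h : HasMarks I s) :
    (outputProg.run s).out = s.out ++ 2 :: I.kernel.encode := by
  have hmarks := h.of_frame (frame_run headerProg s)
  rw [outputProg, run, run_emitSubmatrix hmarks.reg_n (· ∈ kernelSet I.G I.k) hmarks.arr_mark _
    hmarks.arr_adj, h.out_headerProg, encode_kernel, List.append_assoc]
  rfl

def reduceProg : ForProg := seq boundProg (seq rankProg (seq markProg outputProg))

theorem HasStats.out_reduceProg (h : HasStats I s) :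
    (reduceProg.run s).out = s.out ++ 2 :: I.kernel.encode := by
  have hmarks := h.hasBound_boundProg.hasRanks_rankProg.hasMarks_markProg
  rw [reduceProg, run, run, run, hmarks.out_outputProg, (frame_run markProg _).out rfl,
    (frame_run rankProg _).out rfl, (frame_run boundProg _).out rfl]

/-- Other instances can be decided directly: either `G` has no edges or there are too many
colors. -/
def Reducible (I : BInstance) : Prop := 1 ≤ I.Δ ∧ I.k ≤ I.Δ + 1

/-- The kernelization algorithm. -/
noncomputable def kernelization (I : BInstance) : KernelOutput BInstance :=
  if I.Reducible then .reduced I.kernel else .decided (I.k = min I.n 1)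

def reducibleExpr : Expr :=
  (Expr.le (.const 1) (.reg maxDegReg)).and
    (.le (.reg kReg) (.add (.reg maxDegReg) (.const 1)))

theorem HasStats.decides_reducibleExpr (h : HasStats I s) :
    reducibleExpr.Decides s I.Reducible := by
  refine ((Expr.decides_le _ _ s).and (Expr.decides_le _ _ s)).congr ?_
  simp only [Expr.eval, h.reg_maxDeg, h.reg_k, Reducible]

/-- Outputs the truth value of `k = min n 1`. -/
def decideProg : ForProg := emit (.eq (.reg kReg) (.le (.const 1) (.reg nReg)))

theorem HasInput.out_decideProg (h : HasInput I s) :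
    (decideProg.run s).out = s.out ++ [if I.k = min I.n 1 then 1 else 0] := by
  have hmin : (if 1 ≤ I.n then 1 else 0) = min I.n 1 := by split_ifs <;> omega
  rw [decideProg, run, Expr.decides_eq, Expr.decides_le]
  simp only [Expr.eval, h.reg_k, h.reg_n, hmin]

/-- The program of the kernelization algorithm. -/
def kernelProg : Prog :=
  .seq loadProg.compile (.seq statsProg.compile
    (.ite reducibleExpr reduceProg.compile decideProg.compile))

/-- The running time of `kernelProg` in terms of the length of the input. -/
noncomputable def kernelCost : Polynomial ℕ :=
  loadProg.cost + (statsProg.cost + (.C (reducibleExpr.cost + 1) +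
    (reduceProg.cost + decideProg.cost)))

theorem ell_le (I : BInstance) : I.ell ≤ I.n := by
  simpa [ell, ← card_highSet] using card_le_univ (highSet I.G I.k)

theorem Δ_le (I : BInstance) : I.Δ ≤ I.n - 1 :=
  I.G.maxDegree_le_of_forall_degree_le _ fun v => by
    simpa using Nat.le_sub_one_of_lt (I.G.degree_lt_card_verts v)

theorem HasStats.exec_ite (h : HasStats I s) {N : ℕ} (hN : I.n ≤ N) :
    ∃ t ≤ (Polynomial.C (reducibleExpr.cost + 1) + (reduceProg.cost + decideProg.cost)).eval N,
      ∃ s', Exec (.ite reducibleExpr reduceProg.compile decideProg.compile) s t s' ∧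
        s'.out = s.out ++ KernelOutput.encode BInstance.encode I.kernelization := by
  simp only [Polynomial.eval_add, Polynomial.eval_C]
  have htest := h.decides_reducibleExpr.eval_ne_zero_iff
  by_cases hred : I.Reducible
  · have hk : I.k ≤ I.n := by
      have := I.Δ_le
      rw [Reducible] at hred
      omega
    have hbound : ∀ r ∈ ({nReg, kReg, highReg} : Finset ℕ), s.reg r ≤ N := by
      simp only [mem_insert, mem_singleton, forall_eq_or_imp, forall_eq, h.reg_n, h.reg_k,
        h.reg_high]
      exact ⟨hN, hk.trans hN, I.ell_le.trans hN⟩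
    obtain ⟨t, ht, hexec⟩ := exec_compile reduceProg s (by decide) (by decide) fun r hr =>
      hbound r (by revert r; decide)
    refine ⟨_, by omega, _, .iteTrue (htest.2 hred) hexec, ?_⟩
    rw [h.out_reduceProg, kernelization, if_pos hred, KernelOutput.encode]
  · obtain ⟨t, ht, hexec⟩ := exec_compile decideProg (N := N) s (by decide) (by decide)
      fun r hr => absurd hr (by decide +revert)
    refine ⟨_, by omega, _, .iteFalse (not_not.1 (mt htest.1 hred)) hexec, ?_⟩
    rw [h.out_decideProg, kernelization, if_neg hred]
    by_cases hk : I.k = min I.n 1 <;> simp [hk, KernelOutput.encode]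

theorem hasInput_loadProg_init (I : BInstance) : HasInput I (loadProg.run (Ram.init I.encode)) := by
  refine ⟨rfl, rfl, fun u v => ?_⟩
  change I.encode.getD (2 + u * I.n + v) 0 = _
  rw [encode, show 2 + u * I.n + v = (u * I.n + v) + 1 + 1 by ring, List.getD_cons_succ,
    List.getD_cons_succ, getD_flatMap _ _ (by simp) _ (by simp) v.2]
  simp

theorem length_encode (I : BInstance) : I.encode.length = I.n * I.n + 2 := by
  simp [encode, List.length_flatMap]

theorem n_le_bitLength_encode (I : BInstance) : I.n ≤ bitLength I.encode := by
  refine le_trans ?_ (List.length_le_sum_of_one_le _ (by simp))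
  rw [List.length_map, length_encode]
  exact (Nat.le_mul_self _).trans (Nat.le_add_right _ 2)

theorem polyTimeComputable_kernelization : PolyTimeComputable BInstance.encode
    (KernelOutput.encode BInstance.encode) kernelization := by
  refine ⟨kernelProg, kernelCost, fun I => ?_⟩
  have hN := I.n_le_bitLength_encode
  have hinput := I.hasInput_loadProg_init
  obtain ⟨t, ht, hload⟩ := exec_compile loadProg (N := bitLength I.encode) (Ram.init I.encode)
    (by decide) (by decide) fun r hr => absurd hr (by decide +revert)
  obtain ⟨t', ht', hstats⟩ := exec_compile statsProg (N := bitLength I.encode) _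
    (by decide) (by decide) fun r hr => by
      obtain rfl : r = nReg := by revert r; decide
      exact hinput.reg_n.trans_le hN
  obtain ⟨t'', ht'', s, hite, hout⟩ := hinput.hasStats_statsProg.exec_ite hN
  refine ⟨_, s, hload.seq (hstats.seq hite), ?_, ?_⟩
  · rw [hout, (frame_run statsProg _).out rfl, (frame_run loadProg _).out rfl]
    rfl
  · simp only [kernelCost, Polynomial.eval_add] at ht'' ⊢
    gcongr

/-! ### Correctness and size of the kernel -/

theorem hasBColoring_kernel_iff (I : BInstance) :
    HasBColoring I.kernel.G I.kernel.k ↔ HasBColoring I.G I.k :=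
  hasBColoring_comap_iff_of_range_eq_kernelSet
    ⟨I.kernelList.get, List.nodup_iff_injective_get.1 ((List.nodup_finRange _).filter _)⟩ <| by
      ext v
      exact List.mem_iff_get.symm.trans (by simp [kernelList, kernel])

theorem hasBColoring_iff_of_not_reducible (h : ¬ I.Reducible) :
    HasBColoring I.G I.k ↔ I.k = min I.n 1 := by
  rcases Nat.eq_zero_or_pos I.Δ with hΔ | hΔ
  · rw [hasBColoring_iff_of_maxDeg_eq_zero hΔ, Fintype.card_fin]
  · have hk : I.Δ + 1 < I.k := by
      rw [Reducible] at h
      omega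
    exact iff_of_false (fun hcol => hk.not_ge hcol.le_maxDeg_add_one) (by omega)

theorem n_kernel_le (I : BInstance) :
    I.kernel.n ≤ I.ell * (I.Δ + 1) + (I.k ^ 4 + I.ell * I.Δ * I.k) * I.k :=
  I.length_kernelList.trans_le card_kernelSet_le

theorem k_le_Δ_of_lt_ell (h : I.k < I.ell) : I.k ≤ I.Δ := by
  have hpos : 0 < #(highSet I.G I.k) := by
    rw [card_highSet]
    exact (Nat.zero_le _).trans_lt h
  obtain ⟨v, hv⟩ := card_pos.1 hpos
  exact (mem_highSet.1 hv).trans (degree_le_maxDeg v)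

theorem n_kernel_le_of_lt (h : I.k < I.ell) (hΔ : 1 ≤ I.Δ) :
    I.kernel.n ≤ 5 * (I.ell * I.Δ * min I.ell I.Δ ^ (I.ell + 1)) := by
  set m := min I.ell I.Δ
  have hm : 1 ≤ m := le_min (by omega) hΔ
  have hkm : I.k ≤ m := le_min h.le (k_le_Δ_of_lt_ell h)
  have hsq : I.k ^ 2 ≤ m ^ (I.ell + 1) :=
    (Nat.pow_le_pow_left hkm 2).trans (Nat.pow_le_pow_right hm (by omega))
  have hcube : I.k ^ 3 ≤ m ^ (I.ell + 1) := by
    rcases Nat.eq_zero_or_pos I.k with hk | hk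
    · simp [hk]
    · exact (Nat.pow_le_pow_left hkm 3).trans (Nat.pow_le_pow_right hm (by omega))
  have hone : 1 ≤ m ^ (I.ell + 1) := Nat.one_le_pow _ _ hm
  calc I.kernel.n ≤ I.ell * (I.Δ + 1) + (I.k ^ 4 + I.ell * I.Δ * I.k) * I.k := I.n_kernel_le
    _ = I.ell * (I.Δ + 1) + (I.k * I.k * I.k ^ 3 + I.ell * I.Δ * I.k ^ 2) := by ring
    _ ≤ I.ell * (I.Δ + I.Δ) * m ^ (I.ell + 1) + (I.ell * I.Δ * m ^ (I.ell + 1) +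
          I.ell * I.Δ * m ^ (I.ell + 1)) := by
      refine Nat.add_le_add (le_mul_of_le_of_one_le ?_ hone) ?_
      · gcongr
      · gcongr
        exact k_le_Δ_of_lt_ell h
    _ = 4 * (I.ell * I.Δ * m ^ (I.ell + 1)) := by ring
    _ ≤ 5 * (I.ell * I.Δ * m ^ (I.ell + 1)) := by
      gcongr
      norm_num

theorem n_kernel_le_of_le (h : I.ell ≤ I.k) (hred : I.Reducible) :
    I.kernel.n ≤ 5 * (I.k ^ 4 * I.Δ) := by
  obtain ⟨hΔ, hk⟩ := hred
  have hpow : ∀ a ≠ 0, a ≤ 4 → I.k ^ a ≤ I.k ^ 4 := fun a ha0 ha => by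
    rcases Nat.eq_zero_or_pos I.k with hk | hk
    · simp [hk, ha0]
    · exact Nat.pow_le_pow_right hk ha
  calc I.kernel.n ≤ I.ell * (I.Δ + 1) + (I.k ^ 4 + I.ell * I.Δ * I.k) * I.k := I.n_kernel_le
    _ ≤ I.k * (I.Δ + I.Δ) + (I.k ^ 4 * (I.Δ + I.Δ) + I.k * I.Δ * I.k * I.k) := by
      rw [add_mul]
      gcongr
      exact hk.trans (Nat.add_le_add_left hΔ _)
    _ = 2 * (I.k ^ 1 * I.Δ) + 2 * (I.k ^ 4 * I.Δ) + I.k ^ 3 * I.Δ := by ring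
    _ ≤ 2 * (I.k ^ 4 * I.Δ) + 2 * (I.k ^ 4 * I.Δ) + I.k ^ 4 * I.Δ := by
      gcongr 2 * (?_ * _) + _ + ?_ * _
      exacts [hpow 1 one_ne_zero (by simp), hpow 3 three_ne_zero (by simp)]
    _ = 5 * (I.k ^ 4 * I.Δ) := by ring

theorem bitLength_encode_le (I : BInstance) :
    bitLength I.encode ≤ I.n + I.k + 2 + I.n * I.n * 2 := by
  have hrow := bitLength_le_of_forall_le_one (w := I.encode.drop 2) fun x hx => by
    simp only [encode, List.drop_succ_cons, List.drop_zero, List.mem_flatMap, List.mem_map] at hx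
    obtain ⟨u, -, v, -, rfl⟩ := hx
    split_ifs <;> simp
  rw [List.length_drop, length_encode, Nat.add_sub_cancel] at hrow
  have hn := size_le_self I.n
  have hk := size_le_self I.k
  simp only [encode, bitLength, List.drop_succ_cons, List.drop_zero, List.map_cons, List.sum_cons]
    at hrow ⊢
  omega

/-- A bound for the number of vertices of the kernel in terms of the parameter. -/
def vertexBound (m : ℕ) : ℕ := 3 * (m + 1) ^ 5

/-- A bound for the size of the kernel in terms of the parameter. -/
def sizeBound (m : ℕ) : ℕ := vertexBound m * vertexBound m * 2 + 3 * vertexBound m + (m + 3)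

theorem computable_sizeBound : Computable sizeBound := by
  have hadd {f g : ℕ → ℕ} (hf : Primrec f) (hg : Primrec g) : Primrec fun m => f m + g m :=
    Primrec.nat_add.comp hf hg
  have hmul {f g : ℕ → ℕ} (hf : Primrec f) (hg : Primrec g) : Primrec fun m => f m * g m :=
    Primrec.nat_mul.comp hf hg
  have hv : Primrec vertexBound := hmul (.const 3)
    ((Primrec₂.unpaired'.1 Nat.Primrec.pow).comp .succ (.const 5))
  exact (hadd (hadd (hmul (hmul hv hv) (.const 2)) (hmul (.const 3) hv))
    (hadd .id (.const 3))).to_comp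

theorem n_kernel_le_vertexBound (hk : I.k ≤ I.Δ + 1) :
    I.kernel.n ≤ vertexBound (I.Δ + I.ell) := by
  set m := I.Δ + I.ell
  have hΔ : I.Δ ≤ m + 1 := by omega
  have hell : I.ell ≤ m + 1 := by omega
  have hk' : I.k ≤ m + 1 := by omega
  calc I.kernel.n ≤ I.ell * (I.Δ + 1) + (I.k ^ 4 + I.ell * I.Δ * I.k) * I.k := I.n_kernel_le
    _ ≤ (m + 1) * (m + 1) + ((m + 1) ^ 4 + (m + 1) * (m + 1) * (m + 1)) * (m + 1) := by
      gcongr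
      omega
    _ = (m + 1) ^ 2 + (m + 1) ^ 5 + (m + 1) ^ 4 := by ring
    _ ≤ (m + 1) ^ 5 + (m + 1) ^ 5 + (m + 1) ^ 5 := by gcongr <;> omega
    _ = vertexBound m := by rw [vertexBound]; ring

theorem size_kernel_le (hk : I.k ≤ I.Δ + 1) :
    bitLength I.kernel.encode + (I.kernel.Δ + I.kernel.ell) ≤ sizeBound (I.Δ + I.ell) := by
  have hn := n_kernel_le_vertexBound hk
  have hbit := I.kernel.bitLength_encode_le
  have hΔ := I.kernel.Δ_le
  have hell := I.kernel.ell_le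
  have hsq := Nat.mul_le_mul hn hn
  have hk' : I.kernel.k = I.k := rfl
  rw [sizeBound]
  omega

theorem kernelization_eq_reduced {J : BInstance} :
    I.kernelization = .reduced J ↔ I.Reducible ∧ I.kernel = J := by
  rw [kernelization]
  split_ifs with h <;> simp [h]

theorem kernelization_eq_decided {b : Bool} :
    I.kernelization = .decided b ↔ ¬ I.Reducible ∧ decide (I.k = min I.n 1) = b := by
  rw [kernelization]
  split_ifs with h <;> simp [h]

theorem isKernelization_kernelization : IsKernelization bColoringProblem kernelization := by
  refine ⟨polyTimeComputable_kernelization, fun I b h => ?_, fun I J h => ?_, sizeBound,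
    computable_sizeBound, fun I J h => ?_⟩
  · obtain ⟨hred, rfl⟩ := kernelization_eq_decided.1 h
    exact decide_eq_true_iff.trans (hasBColoring_iff_of_not_reducible hred).symm
  · obtain ⟨-, rfl⟩ := kernelization_eq_reduced.1 h
    exact I.hasBColoring_kernel_iff.symm
  · obtain ⟨hred, rfl⟩ := kernelization_eq_reduced.1 h
    exact size_kernel_le hred.2

end BInstance

theorem mainTheorem11 :
    ∃ K : BInstance → KernelOutput BInstance,
      IsKernelization bColoringProblem K ∧
      ∃ C : ℕ, ∀ I J : BInstance, K I = .reduced J →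
        (I.k < I.ell → J.n ≤ C * (I.ell * I.Δ * (min I.ell I.Δ) ^ (I.ell + 1))) ∧
        (I.ell ≤ I.k → J.n ≤ C * (I.k ^ 4 * I.Δ)) := by
  refine ⟨BInstance.kernelization, BInstance.isKernelization_kernelization, 5, fun I J h => ?_⟩
  obtain ⟨hred, rfl⟩ := BInstance.kernelization_eq_reduced.1 h
  exact ⟨fun hlt => BInstance.n_kernel_le_of_lt hlt hred.1,
    fun hle => BInstance.n_kernel_le_of_le hle hred⟩
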